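/- Let $n\ge 1$. Let $(W,\{r_1,\dots,r_{2n}\})$ be the Weyl group of type $C_{2n}$ with its simple reflections, numbered so that $r_{2n-1}r_{2n}$ has order $4$. Put $J=\{r_1,r_3,\dots,r_{2n-1}\}$ and $$\overline\tau_{2n}=(r_{2n}r_{2n-1}\cdots r_{n+1})\cdots(r_{2n}r_{2n-1}r_{2n-2})(r_{2n}r_{2n-1})\,r_{2n}\cdot(r_nr_{n+1}\cdots r_{2n-2})\cdots(r_4r_5r_6)(r_3r_4)\,r_2\in W$$ (for $k=n,\dots,1$ the blocks $r_{2n}r_{2n-1}\cdots r_{2n-k+1}$, then for $k=n,\dots,2$ the blocks $r_kr_{k+1}\cdots r_{2k-2}$). Let $W^J_{\le\overline\tau_{2n}}$ be the set of $w\in W$ that have minimal length in their coset $wW_J$, where $W_J=\langle J\rangle$, and satisfy $w\le\overline\tau_{2n}$ in the Bruhat order. A symplectic Dellac configuration is a board with $2n$ rows and $4n$ columns and $4n$ marked cells such that each column contains exactly one marked cell, each row contains exactly two, every marked cell $(i,j)$ satisfies $i\le j\le 2n+i$, and $(i,j)$ is marked if and only if $(2n+1-i,4n+1-j)$ is. Let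 $\mathrm{SpDC}_{2n}$ be the set of these and $e_n$ its cardinality. Then $W^J_{\le\overline\tau_{2n}}$ is finite and $$e_n=\#W^J_{\le\overline\tau_{2n}}.$$ Moreover the equality is realized by an explicit bijection. Write $s_i=(i,i+1)\in\mathfrak S_{4n}$, let $\tau_{2n}=(s_{2n}s_{2n+1}\cdots s_{4n-2})\cdots(s_3s_4)s_2$ (for $k=2n,\dots,2$ the blocks $s_ks_{k+1}\cdots s_{2k-2}$), and let $\iota(\sigma)(k)=4n+1-\sigma(4n+1-k)$ for $\sigma\in\mathfrak S_{4n}$. There is an injective homomorphism $\kappa:W\to\mathfrak S_{4n}$ with $\kappa(r_i)=s_is_{4n-i}$ for $1\le i\le 2n-1$ and $\kappa(r_{2n})=s_{2n}$; its image is the set of $\iota$-fixed permutations, and $\kappa(\overline\tau_{2n})=\tau_{2n}$. For $\sigma\in\mathfrak S_{4n}$ let $R_\sigma$ be the $4n\times4n$ board with marked cells $(i,\sigma(i))$. Let $\mathcal{SR}_{\le\tau_{2n}}$ be the set of $4n\times 4n$ boards with exactly one mark in each row and each column that are invariant under $(i,j)\mapsto(4n+1-i,4n+1-j)$ and all of whose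 marked cells $(i,j)$ lie in the convex hull of $R_{\tau_{2n}}$, i.e. $R_{\tau_{2n}}$ has a mark $(i',j')$ with $i'\ge i$, $j'\le j$ and a mark $(i'',j'')$ with $i''\le i$, $j''\ge j$. The melt map $\mathbf m$ merges rows $2k-1$ and $2k$ of a $4n\times4n$ board into row $k$ of a board with $2n$ rows, for $1\le k\le 2n$; the blow map $\mathbf b$ sends the two marked cells $(i,j),(i,k)$, $j<k$, of each row of a Dellac configuration to $(2i-1,j)$ and $(2i,k)$. Then $\mathbf b$ maps $\mathrm{SpDC}_{2n}$ into $\mathcal{SR}_{\le\tau_{2n}}$, $\mathbf m$ maps $\mathcal{SR}_{\le\tau_{2n}}$ into $\mathrm{SpDC}_{2n}$, $\mathbf m(\mathbf b(C))=C$ for every $C\in\mathrm{SpDC}_{2n}$, the map $w\mapsto\mathbf m(R_{\kappa(w)})$ is a bijection $W^J_{\le\overline\tau_{2n}}\to\mathrm{SpDC}_{2n}$, and $w\mapsto R_{\kappa(w)}$ is a bijection from $W^J_{\le\overline\tau_{2n}}$ onto $\mathbf b(\mathrm{SpDC}_{2n})$. -/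

import Mathlib

namespace SymplecticDellac

/-! ### Bruhat order and minimal coset representatives in a Coxeter group -/

section Coxeter

variable {B W : Type*} [Group W] {M : CoxeterMatrix B}

/-- The Bruhat order: `u ≤ w` if there is a chain `u = u₀, u₁, …, u_k = w` in which every `u_{i+1}`
is `u_i` times a reflection and `ℓ(u_i) < ℓ(u_{i+1})`. -/
def BruhatLE (cs : CoxeterSystem M W) : W → W → Prop :=
  Relation.ReflTransGen fun u v =>
    ∃ t : W, cs.IsReflection t ∧ v = u * t ∧ cs.length u < cs.length v

/-- The standard parabolic subgroup `W_J`. -/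
def parabolic (cs : CoxeterSystem M W) (J : Set B) : Subgroup W :=
  Subgroup.closure (cs.simple '' J)

/-- `W^J`: the elements of minimal length in their coset `w W_J`. -/
def minReps (cs : CoxeterSystem M W) (J : Set B) : Set W :=
  {w | ∀ u ∈ parabolic cs J, cs.length w ≤ cs.length (w * u)}

/-- `W^J_{≤ τ}`. -/
def minRepsLE (cs : CoxeterSystem M W) (J : Set B) (τ : W) : Set W :=
  {w | w ∈ minReps cs J ∧ BruhatLE cs w τ}

end Coxeter

/-! ### The Weyl group of type `C_{2n}`

The Weyl group of `Sp_{4n}` is the Coxeter group of type `B_{2n} = C_{2n}`. The generator `r_i`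
(`1 ≤ i ≤ 2n`) is the simple reflection with index `i - 1` in `Fin (2n)`; the edge labelled `4` joins
`r_{2n-1}` and `r_{2n}`. -/

section TypeC

variable {W : Type*} [Group W] {n : ℕ}

/-- The generator `r_i`, for `1 ≤ i ≤ 2n` (and `1` for other `i`). -/
def r (cs : CoxeterSystem (CoxeterMatrix.B (2 * n)) W) (i : ℕ) : W :=
  if h : 1 ≤ i ∧ i ≤ 2 * n then cs.simple ⟨i - 1, by omega⟩ else 1

/-- `J = {r_1, r_3, …, r_{2n-1}}`, as a set of (zero-based) indices. -/
def J (n : ℕ) : Set (Fin (2 * n)) := {i | Even (i : ℕ)}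

/-- The list `[m, m - 1, …, 1]`. -/
def downFrom (m : ℕ) : List ℕ := (List.range' 1 m).reverse

/-- `τ̄_{2n} = (r_{2n} ⋯ r_{n+1}) ⋯ (r_{2n} r_{2n-1}) r_{2n} · (r_n ⋯ r_{2n-2}) ⋯ (r_3 r_4) r_2`:
for `k = n, …, 1` the blocks `r_{2n} r_{2n-1} ⋯ r_{2n-k+1}`, and then for `k = n, …, 1` the blocks
`r_k r_{k+1} ⋯ r_{2k-2}` (empty for `k = 1`). -/
def tauBar (cs : CoxeterSystem (CoxeterMatrix.B (2 * n)) W) : W :=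
  ((downFrom n).map fun k => ((List.range k).map fun a => r cs (2 * n - a)).prod).prod *
  ((downFrom n).map fun k => ((List.range (k - 1)).map fun a => r cs (k + a)).prod).prod

end TypeC

/-! ### The symmetric group `𝔖_{2m}`

The letters `1, …, 2m` are the elements `0, …, 2m - 1` of `Fin (2m)`. -/

/-- The adjacent transposition `s_i = (i, i+1)` of `{1, …, N}`, for `1 ≤ i < N`
(and `1` for other `i`). -/
def s (N i : ℕ) : Equiv.Perm (Fin N) :=
  if h : 1 ≤ i ∧ i < N then Equiv.swap ⟨i - 1, by omega⟩ ⟨i, by omega⟩ else 1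

/-- `τ_m = (s_m s_{m+1} ⋯ s_{2m-2}) ⋯ (s_3 s_4) s_2` in `𝔖_{2m}`. -/
def tau (m : ℕ) : Equiv.Perm (Fin (2 * m)) :=
  ((downFrom m).map fun k => ((List.range (k - 1)).map fun a => s (2 * m) (k + a)).prod).prod

/-- The involution `ι(σ)(k) = N + 1 - σ(N + 1 - k)` of `𝔖_N`. -/
def iota {N : ℕ} (σ : Equiv.Perm (Fin N)) : Equiv.Perm (Fin N) :=
  Fin.revPerm * σ * Fin.revPerm

/-- The image `s_i s_{4n-i}` (for `1 ≤ i ≤ 2n - 1`), respectively `s_{2n}` (for `i = 2n`), of the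
generator `r_i` in `𝔖_{4n}`. -/
def kappaGen (n i : ℕ) : Equiv.Perm (Fin (2 * (2 * n))) :=
  if i = 2 * n then s (2 * (2 * n)) (2 * n)
  else s (2 * (2 * n)) i * s (2 * (2 * n)) (4 * n - i)

/-! ### Boards -/

/-- A board with `a` rows and `b` columns, given by its set of marked cells `(row, column)`. -/
abbrev Board (a b : ℕ) := Set (Fin a × Fin b)

/-- Dellac configurations with `m` rows and `2m` columns. The inequalities are unchanged by the
shift of both indices to zero-based ones. -/
structure IsDellac (m : ℕ) (C : Board m (2 * m)) : Prop where
  card : C.ncard = 2 * m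
  col : ∀ j, ∃! i, (i, j) ∈ C
  row : ∀ i, {j | (i, j) ∈ C}.ncard = 2
  bound : ∀ i j, (i, j) ∈ C → (i : ℕ) ≤ j ∧ (j : ℕ) ≤ m + i

/-- `SpDC_{2n}`: symplectic Dellac configurations, with `2n` rows and `4n` columns; the cell `(i, j)`
is marked iff `(2n - i + 1, 4n - j + 1)` is. -/
def SpDC (n : ℕ) : Set (Board (2 * n) (2 * (2 * n))) :=
  {C | IsDellac (2 * n) C ∧ ∀ i j, (i, j) ∈ C ↔ (i.rev, j.rev) ∈ C}

/-- `e_n`, the number of symplectic Dellac configurations. -/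
noncomputable def e (n : ℕ) : ℕ := (SpDC n).ncard

/-- Rook arrangements: one mark in each row and each column. -/
def IsRook {N : ℕ} (R : Board N N) : Prop :=
  (∀ i, ∃! j, (i, j) ∈ R) ∧ (∀ j, ∃! i, (i, j) ∈ R)

/-- The rook arrangement `R_σ` of a permutation: `(i, j)` is marked iff `σ(i) = j`. -/
def rook {N : ℕ} (σ : Equiv.Perm (Fin N)) : Board N N := {p | σ p.1 = p.2}

/-- The convex hull (right hull) of the marked cells of `R`: the smallest right-aligned skew-Ferrers
board containing them. It consists of the cells with a marked cell weakly below and to the left and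
a marked cell weakly above and to the right. -/
def hull {N : ℕ} (R : Board N N) : Board N N :=
  {p | (∃ q ∈ R, p.1 ≤ q.1 ∧ q.2 ≤ p.2) ∧ (∃ q ∈ R, q.1 ≤ p.1 ∧ p.2 ≤ q.2)}

/-- `SR_{≤ τ_{2n}}`: rook arrangements on the `4n × 4n` board that are invariant under
`(i, j) ↦ (4n + 1 - i, 4n + 1 - j)` and contained in the convex hull of the marks of `R_{τ_{2n}}`. -/
def SR (n : ℕ) : Set (Board (2 * (2 * n)) (2 * (2 * n))) :=
  {R | IsRook R ∧ (∀ i j, (i, j) ∈ R ↔ (i.rev, j.rev) ∈ R) ∧ R ⊆ hull (rook (tau (2 * n)))}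

/-- The melt map: merge the rows `2k - 1` and `2k` into row `k`. -/
def melt {m : ℕ} (R : Board (2 * m) (2 * m)) : Board m (2 * m) :=
  {p | ∃ a : Fin (2 * m), (a : ℕ) / 2 = p.1 ∧ (a, p.2) ∈ R}

/-- The blow map: if the cells `(i, j)` and `(i, k)` with `j < k` are marked in `C`, mark the cells
`(2i - 1, j)` and `(2i, k)`. -/
def blow {m : ℕ} (C : Board m (2 * m)) : Board (2 * m) (2 * m) :=
  {p | ∃ (i : Fin m) (j k : Fin (2 * m)), (i, j) ∈ C ∧ (i, k) ∈ C ∧ j < k ∧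
    (((p.1 : ℕ) = 2 * i ∧ p.2 = j) ∨ ((p.1 : ℕ) = 2 * i + 1 ∧ p.2 = k))}

end SymplecticDellac

/-! Through `kappa` the Weyl group becomes the group of permutations of `2m` letters (`m = 2n`) that
commute with reversal, and everything is read off in one-line notation. Injectivity of `kappa` is
proved from the Coxeter presentation, by rewriting elements into words that represent the cosets of
the stabilizer of a letter (`kappa_injective`). Reflections correspond exactly to the
mirror-symmetric transpositions `symSwap a b`, and multiplying `w` on the right by such a reflection
with `a < b` raises the length iff the value at `a` is below the value at `b`
(`length_lt_length_mul_iff`).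

Two translations follow. Minimality in the coset of `W_J` means increasing on each pair of positions
`{2k, 2k+1}` (`mem_minReps_iff`). Among such elements, lying below the shuffle `1, m+1, 2, m+2, …`
means the bound `σ x ≤ m + x / 2` (`mem_minRepsLE_iff`). The bound passes down every Bruhat step.
Conversely, a bounded pair-increasing permutation other than the shuffle can be raised by a
reflection without leaving the class (`exists_larger`), and since lengths are bounded the climb ends
at the shuffle. The delicate point is the counting in `div_two_le_of_nearest`, which shows that the
chosen swap respects the bounds.

By symmetry the upper bound is equivalent to a lower bound, and together they are the Dellac
inequalities after merging the rows in pairs. A Dellac configuration determines one pair-increasing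
permutation, and central symmetry of the board is symmetry of that permutation. So `melt` is a
bijection on the interval, and `blow` recovers the permutation. -/

namespace SymplecticDellac
open Equiv

/-! ### Centrally symmetric permutations -/

/-- The permutation commutes with the reversal of `Fin N`. -/
def IsSym {N : ℕ} (σ : Perm (Fin N)) : Prop := ∀ x, σ x.rev = (σ x).rev

theorem iota_eq_self_iff {N : ℕ} (σ : Perm (Fin N)) : iota σ = σ ↔ IsSym σ := by
  constructor
  · intro h x
    conv_lhs => rw [← h]
    simp [iota]
  · intro h
    ext1 x
    simp [iota, h x]

namespace IsSym

variable {N : ℕ} {σ τ : Perm (Fin N)}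

theorem one : IsSym (1 : Perm (Fin N)) := fun _ => rfl

theorem mul (hσ : IsSym σ) (hτ : IsSym τ) : IsSym (σ * τ) := fun x => by
  simp [hτ x, hσ (τ x)]

theorem inv (hσ : IsSym σ) : IsSym σ⁻¹ := fun x => by
  apply σ.injective
  rw [hσ]
  simp

end IsSym

/-- The product of the transposition of `a` and `b` with its image under the reversal, or just the
transposition if `a` and `b` are opposite to each other. -/
def symSwap {N : ℕ} (a b : Fin N) : Perm (Fin N) :=
  if b = a.rev then swap a b else swap a b * swap a.rev b.rev

/-- This reduces the braid relations, and every later conjugation of a reflection, to computing the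
images of two letters. -/
theorem symSwap_conj {N : ℕ} {g : Perm (Fin N)} (hg : IsSym g) (a b : Fin N) :
    g * symSwap a b * g⁻¹ = symSwap (g a) (g b) := by
  have h : (g b = (g a).rev) = (b = a.rev) := by
    rw [← hg a]; simp
  unfold symSwap
  simp only [h]
  split_ifs with h1
  · rw [swap_apply_apply]
  · rw [← hg a, ← hg b, swap_apply_apply, swap_apply_apply]
    group

variable {m : ℕ}

theorem rev_ne_self (a : Fin (2 * m)) : a.rev ≠ a := by
  intro h
  have := congrArg Fin.val h
  rw [Fin.val_rev] at this
  omega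

theorem symSwap_apply (a b x : Fin (2 * m)) :
    symSwap a b x = if x = a then b else if x = b then a else
      if x = a.rev then b.rev else if x = b.rev then a.rev else x := by
  have ha := rev_ne_self a
  have hb := rev_ne_self b
  unfold symSwap
  split_ifs with h1 <;> simp only [Perm.mul_apply, swap_apply_def] <;> grind [Fin.rev_rev]

@[simp]
theorem symSwap_apply_left (a b : Fin (2 * m)) : symSwap a b a = b := by
  simp [symSwap_apply]

@[simp]
theorem symSwap_apply_right (a b : Fin (2 * m)) : symSwap a b b = a := by
  simp only [symSwap_apply]; split_ifs <;> simp_all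

theorem symSwap_isSym (a b : Fin (2 * m)) : IsSym (symSwap a b) := by
  intro x
  have ha := rev_ne_self a
  have hb := rev_ne_self b
  simp only [symSwap_apply]
  grind [Fin.rev_rev]

theorem symSwap_mul_self (a b : Fin (2 * m)) : symSwap a b * symSwap a b = 1 := by
  ext1 x
  have ha := rev_ne_self a
  have hb := rev_ne_self b
  simp only [symSwap_apply, Perm.mul_apply, Perm.one_apply]
  grind [Fin.rev_rev]

theorem symSwap_comm (a b : Fin (2 * m)) : symSwap a b = symSwap b a := by
  ext1 x
  have ha := rev_ne_self a
  have hb := rev_ne_self b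
  simp only [symSwap_apply]
  grind [Fin.rev_rev]

theorem symSwap_rev (a b : Fin (2 * m)) : symSwap a.rev b.rev = symSwap a b := by
  ext1 x
  have ha := rev_ne_self a
  have hb := rev_ne_self b
  simp only [symSwap_apply, Fin.rev_rev]
  grind [Fin.rev_rev]

/-- Only one transposition and its mirror image exchange `a` and `b`. -/
theorem symSwap_eq_of_apply {a b c d : Fin (2 * m)} (h : symSwap c d a = b) (hab : a ≠ b) :
    symSwap c d = symSwap a b := by
  rw [symSwap_apply] at h
  split_ifs at h with h1 h2 h3 h4
  · rw [h1, h]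
  · rw [h2, h, symSwap_comm]
  · rw [← h, h3, symSwap_rev]
  · rw [← h, h4, symSwap_rev, symSwap_comm]
  · exact absurd h hab

/-! ### The generators of the group of centrally symmetric permutations -/

/-- The image of the simple reflection with (zero-based) index `i`. -/
def gen (m : ℕ) (i : Fin m) : Perm (Fin (2 * m)) :=
  symSwap ⟨i, by omega⟩ ⟨i + 1, by omega⟩

theorem gen_apply_val (i : Fin m) (x : Fin (2 * m)) :
    (gen m i x : ℕ) = if (x : ℕ) = i then (i : ℕ) + 1 else if (x : ℕ) = i + 1 then (i : ℕ) else
      if (x : ℕ) + i + 1 = 2 * m then 2 * m - i - 2 else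
      if (x : ℕ) + i + 2 = 2 * m then 2 * m - i - 1 else x := by
  simp only [gen, symSwap_apply, Fin.ext_iff, Fin.val_rev]
  split_ifs <;> (try simp only [Fin.val_rev]) <;> omega

theorem gen_isSym (i : Fin m) : IsSym (gen m i) := symSwap_isSym _ _

theorem gen_mul_self (i : Fin m) : gen m i * gen m i = 1 := symSwap_mul_self _ _

theorem gen_conj_gen (i j : Fin m) : gen m i * gen m j * gen m i =
    symSwap (gen m i ⟨j, by omega⟩) (gen m i ⟨j + 1, by omega⟩) := by
  have h := symSwap_conj (gen_isSym i) ⟨j, by omega⟩ ⟨j + 1, by omega⟩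
  rwa [inv_eq_of_mul_eq_one_left (gen_mul_self i)] at h

theorem gen_commute {i j : Fin m} (h : (i : ℕ) + 1 < j) :
    gen m i * gen m j = gen m j * gen m i := by
  have h1 : gen m i * gen m j * gen m i = gen m j := by
    rw [gen_conj_gen]
    conv_rhs => rw [gen]
    congr 1 <;> ext <;> simp only [gen_apply_val] <;> split_ifs <;> omega
  calc gen m i * gen m j = gen m i * gen m j * gen m i * gen m i := by
        rw [mul_assoc _ (gen m i) (gen m i), gen_mul_self, mul_one]
    _ = gen m j * gen m i := by rw [h1]

theorem gen_braid_three {i j : Fin m} (h : (i : ℕ) + 1 = j) (hj : (j : ℕ) + 1 < m) :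
    gen m i * gen m j * gen m i = gen m j * gen m i * gen m j := by
  rw [gen_conj_gen, gen_conj_gen]
  congr 1 <;> ext <;> simp only [gen_apply_val] <;> split_ifs <;> omega

/-- The conjugate of the last generator by its neighbour exchanges the letters `m - 2` and `m + 1`,
so it commutes with the last generator, which exchanges `m - 1` and `m`. -/
theorem gen_braid_four {i j : Fin m} (h : (i : ℕ) + 1 = j) (hj : (j : ℕ) + 1 = m) :
    gen m i * gen m j * gen m i * gen m j = gen m j * gen m i * gen m j * gen m i := by
  have h1 : gen m j * (gen m i * gen m j * gen m i) * gen m j =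
      gen m i * gen m j * gen m i := by
    have h2 := symSwap_conj (gen_isSym j) (gen m i ⟨j, by omega⟩) (gen m i ⟨j + 1, by omega⟩)
    rw [inv_eq_of_mul_eq_one_left (gen_mul_self j), ← gen_conj_gen] at h2
    rw [h2, gen_conj_gen]
    congr 1 <;> ext <;> simp only [gen_apply_val] <;> split_ifs <;> omega
  calc gen m i * gen m j * gen m i * gen m j
      = gen m j * (gen m i * gen m j * gen m i) * gen m j * gen m j := by rw [h1]
    _ = gen m j * gen m i * gen m j * gen m i := by
        rw [mul_assoc _ (gen m j) (gen m j), gen_mul_self]; simp only [mul_one, mul_assoc]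

end SymplecticDellac

namespace SymplecticDellac
open Equiv

/-! ### Braid relations and orders of products of two involutions. -/

section Relations

theorem typeB_apply {m : ℕ} (i j : Fin m) : CoxeterMatrix.B m i j =
    if (i : ℕ) = j then 1
    else if ((i : ℕ) = m - 1 ∧ (j : ℕ) = m - 2) ∨ ((j : ℕ) = m - 1 ∧ (i : ℕ) = m - 2) then 4
    else if (j : ℕ) + 1 = i ∨ (i : ℕ) + 1 = j then 3 else 2 := by
  simp only [← Fin.ext_iff]
  rfl

theorem mul_pow_three_of_braid {G : Type*} [Group G] {a b : G} (ha : a * a = 1) (hb : b * b = 1)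
    (h : a * b * a = b * a * b) : (a * b) ^ 3 = 1 := by
  calc (a * b) ^ 3 = (a * b * a) * (b * a * b) := by
        simp only [pow_succ, pow_zero, one_mul, mul_assoc]
    _ = (a * b * a) * (a * b * a) := by rw [h]
    _ = a * b * (a * a) * b * a := by simp only [mul_assoc]
    _ = 1 := by rw [ha, mul_one, mul_assoc a b b, hb, mul_one, ha]

theorem mul_pow_four_of_braid {G : Type*} [Group G] {a b : G} (ha : a * a = 1) (hb : b * b = 1)
    (h : a * b * a * b = b * a * b * a) : (a * b) ^ 4 = 1 := by
  calc (a * b) ^ 4 = (a * b * a * b) * (a * b * a * b) := by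
        simp only [pow_succ, pow_zero, one_mul, mul_assoc]
    _ = (a * b * a * b) * (b * a * b * a) := by rw [h]
    _ = a * b * a * (b * b) * a * b * a := by simp only [mul_assoc]
    _ = a * b * (a * a) * b * a := by rw [hb, mul_one]; simp only [mul_assoc]
    _ = 1 := by rw [ha, mul_one, mul_assoc a b b, hb, mul_one, ha]

theorem braid_of_mul_pow_two {G : Type*} [Group G] {a b : G} (ha : a * a = 1) (hb : b * b = 1)
    (h : (a * b) ^ 2 = 1) : a * b = b * a := by
  have ha' : a⁻¹ = a := inv_eq_of_mul_eq_one_left ha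
  have hb' : b⁻¹ = b := inv_eq_of_mul_eq_one_left hb
  have := eq_inv_of_mul_eq_one_left ((pow_two (a * b)).symm.trans h)
  rwa [mul_inv_rev, ha', hb'] at this

theorem braid_of_mul_pow_three {G : Type*} [Group G] {a b : G} (ha : a * a = 1) (hb : b * b = 1)
    (h : (a * b) ^ 3 = 1) : a * b * a = b * a * b := by
  have ha' : a⁻¹ = a := inv_eq_of_mul_eq_one_left ha
  have hb' : b⁻¹ = b := inv_eq_of_mul_eq_one_left hb
  have h' : (a * b * a) * (b * a * b) = 1 := by
    rw [← h]; simp only [pow_succ, pow_zero, one_mul, mul_assoc]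
  have := eq_inv_of_mul_eq_one_left h'
  rwa [mul_inv_rev, mul_inv_rev, ha', hb', ← mul_assoc] at this

theorem braid_of_mul_pow_four {G : Type*} [Group G] {a b : G} (ha : a * a = 1) (hb : b * b = 1)
    (h : (a * b) ^ 4 = 1) : a * b * a * b = b * a * b * a := by
  have ha' : a⁻¹ = a := inv_eq_of_mul_eq_one_left ha
  have hb' : b⁻¹ = b := inv_eq_of_mul_eq_one_left hb
  have h' : (a * b * a * b) * (a * b * a * b) = 1 := by
    rw [← h]; simp only [pow_succ, pow_zero, one_mul, mul_assoc]
  have := eq_inv_of_mul_eq_one_left h'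
  rwa [mul_inv_rev, mul_inv_rev, mul_inv_rev, ha', hb', ← mul_assoc, ← mul_assoc] at this

end Relations

/-! ### The homomorphism to the symmetric group, and relations among the simple reflections. -/

variable {W : Type*} [Group W] {m : ℕ} (cs : CoxeterSystem (CoxeterMatrix.B m) W)

theorem gen_isLiftable (m : ℕ) : (CoxeterMatrix.B m).IsLiftable (gen m) := by
  intro i j
  rw [typeB_apply]
  have hi := gen_mul_self i
  have hj := gen_mul_self j
  have comm : ∀ i j : Fin m, gen m i * gen m j = gen m j * gen m i →
      (gen m i * gen m j) ^ 2 = 1 := by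
    intro i j h
    rw [pow_two]
    nth_rw 2 [h]
    rw [mul_assoc, ← mul_assoc (gen m j), gen_mul_self, one_mul, gen_mul_self]
  split_ifs with h1 h2 h3
  · rw [Fin.ext h1, pow_one, gen_mul_self]
  · apply mul_pow_four_of_braid hi hj
    rcases h2 with h2 | h2
    · exact (gen_braid_four (by omega) (by omega)).symm
    · exact gen_braid_four (by omega) (by omega)
  · apply mul_pow_three_of_braid hi hj
    rcases h3 with h3 | h3
    · exact (gen_braid_three (by omega) (by omega)).symm
    · exact gen_braid_three (by omega) (by omega)
  · apply comm
    rcases Nat.lt_or_gt_of_ne h1 with h | h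
    · exact gen_commute (by omega)
    · exact (gen_commute (by omega)).symm

/-- The homomorphism from the Weyl group of type `C_m` to the symmetric group on `2m` letters. -/
noncomputable def kappa : W →* Perm (Fin (2 * m)) := cs.lift ⟨gen m, gen_isLiftable m⟩

theorem kappa_simple (i : Fin m) : kappa cs (cs.simple i) = gen m i :=
  cs.lift_apply_simple (gen_isLiftable m) i

theorem kappa_isSym (w : W) : IsSym (kappa cs w) := by
  induction w using cs.simple_induction_left with
  | one => simpa using IsSym.one
  | mul_simple_left w i ih =>
    rw [map_mul, kappa_simple]
    exact (gen_isSym i).mul ih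

/-- The simple reflection with zero-based index `j`, or `1` if the index is out of range. -/
noncomputable def simpleNat (j : ℕ) : W := if h : j < m then cs.simple ⟨j, h⟩ else 1

theorem simpleNat_mul_self (j : ℕ) : simpleNat cs j * simpleNat cs j = 1 := by
  unfold simpleNat; split_ifs <;> simp

theorem simpleNat_mul_cancel (j : ℕ) (w : W) : simpleNat cs j * (simpleNat cs j * w) = w := by
  rw [← mul_assoc, simpleNat_mul_self, one_mul]

theorem simpleNat_inv (j : ℕ) : (simpleNat cs j)⁻¹ = simpleNat cs j :=
  inv_eq_of_mul_eq_one_left (simpleNat_mul_self cs j)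

theorem simpleNat_mul_pow {i j : ℕ} (hi : i < m) (hj : j < m) :
    (simpleNat cs i * simpleNat cs j) ^ (CoxeterMatrix.B m ⟨i, hi⟩ ⟨j, hj⟩) = 1 := by
  simp only [simpleNat, hi, hj, dite_true, cs.simple_mul_simple_pow]

theorem simpleNat_commute {i j : ℕ} (h : i + 1 < j) :
    simpleNat cs i * simpleNat cs j = simpleNat cs j * simpleNat cs i := by
  by_cases hj : j < m
  · apply braid_of_mul_pow_two (simpleNat_mul_self cs i) (simpleNat_mul_self cs j)
    have := simpleNat_mul_pow cs (show i < m by omega) hj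
    rwa [typeB_apply, if_neg (by dsimp only; omega), if_neg (by dsimp only; omega),
      if_neg (by dsimp only; omega)] at this
  · have : simpleNat cs j = 1 := by simp [simpleNat, hj]
    rw [this, one_mul, mul_one]

theorem simpleNat_braid_three {i : ℕ} (h : i + 2 < m) :
    simpleNat cs i * simpleNat cs (i + 1) * simpleNat cs i =
      simpleNat cs (i + 1) * simpleNat cs i * simpleNat cs (i + 1) := by
  apply braid_of_mul_pow_three (simpleNat_mul_self cs i) (simpleNat_mul_self cs _)
  have := simpleNat_mul_pow cs (show i < m by omega) (show i + 1 < m by omega)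
  rwa [typeB_apply, if_neg (by dsimp only; omega), if_neg (by dsimp only; omega),
    if_pos (by dsimp only; omega)] at this

theorem simpleNat_braid_four {i : ℕ} (h : i + 2 = m) :
    simpleNat cs (i + 1) * simpleNat cs i * simpleNat cs (i + 1) * simpleNat cs i =
      simpleNat cs i * simpleNat cs (i + 1) * simpleNat cs i * simpleNat cs (i + 1) := by
  symm
  apply braid_of_mul_pow_four (simpleNat_mul_self cs i) (simpleNat_mul_self cs _)
  have := simpleNat_mul_pow cs (show i < m by omega) (show i + 1 < m by omega)
  rwa [typeB_apply, if_neg (by dsimp only; omega), if_pos (by dsimp only; omega)] at this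

theorem kappa_simpleNat {j : ℕ} (hj : j < m) : kappa cs (simpleNat cs j) = gen m ⟨j, hj⟩ := by
  rw [simpleNat, dif_pos hj, kappa_simple]

theorem kappa_simpleNat_apply_val {j : ℕ} (hj : j < m) (x : Fin (2 * m)) :
    (kappa cs (simpleNat cs j) x : ℕ) = if (x : ℕ) = j then j + 1 else
      if (x : ℕ) = j + 1 then j else
      if (x : ℕ) + j + 1 = 2 * m then 2 * m - j - 2 else
      if (x : ℕ) + j + 2 = 2 * m then 2 * m - j - 1 else x := by
  rw [kappa_simpleNat cs hj, gen_apply_val]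

/-! ### Coset representatives of the stabilizer of a letter -/

/-- The product `r_{k+q-1} ⋯ r_{k+1} r_k` (zero-based indices). -/
noncomputable def descWord (k : ℕ) : ℕ → W
  | 0 => 1
  | q + 1 => simpleNat cs (k + q) * descWord k q

/-- The product `r_{m-1-p} ⋯ r_{m-2} r_{m-1} r_{m-2} ⋯ r_{k+1} r_k` (zero-based indices). -/
noncomputable def turnWord (k : ℕ) : ℕ → W
  | 0 => descWord cs k (m - k)
  | p + 1 => simpleNat cs (m - 2 - p) * turnWord k p

theorem simpleNat_mul_descWord_of_gt {k q j : ℕ} (h : k + q < j) :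
    simpleNat cs j * descWord cs k q = descWord cs k q * simpleNat cs j := by
  induction q with
  | zero => simp [descWord]
  | succ q ih =>
    rw [descWord, ← mul_assoc, ← simpleNat_commute cs (by omega), mul_assoc, ih (by omega),
      mul_assoc]

/-- The letter commutes with the word until it meets `r_{j+1} r_j`; the braid relation there turns
it into `r_{j+1}`, which commutes with the rest. -/
theorem simpleNat_mul_descWord_of_lt {k q j : ℕ} (hk : k ≤ j) (hq : j + 1 < k + q)
    (hm : j + 2 < m) :
    simpleNat cs j * descWord cs k q = descWord cs k q * simpleNat cs (j + 1) := by
  induction q with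
  | zero => omega
  | succ q ih =>
    rcases Nat.lt_or_ge (j + 1) (k + q) with h | h
    · rw [descWord, ← mul_assoc, simpleNat_commute cs h, mul_assoc, ih h, mul_assoc]
    · obtain ⟨p, rfl⟩ : ∃ p, q = p + 1 := ⟨q - 1, by omega⟩
      obtain rfl : j = k + p := by omega
      simp only [descWord]
      rw [← mul_assoc, ← mul_assoc, ← Nat.add_assoc, simpleNat_braid_three cs hm, mul_assoc,
        simpleNat_mul_descWord_of_gt cs (by omega)]
      simp only [mul_assoc]

theorem simpleNat_mul_turnWord_of_lt {k p j : ℕ} (hk : k ≤ j) (h : j + 2 + p < m) :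
    simpleNat cs j * turnWord cs k p = turnWord cs k p * simpleNat cs (j + 1) := by
  induction p with
  | zero => exact simpleNat_mul_descWord_of_lt cs hk (by omega) (by omega)
  | succ p ih =>
    rw [turnWord, ← mul_assoc, simpleNat_commute cs (by omega), mul_assoc, ih (by omega),
      mul_assoc]

/-- The letter is met twice: the ascending part of the word lowers its index by one and the
descending part raises it again. -/
theorem simpleNat_mul_turnWord_of_gt {k p j : ℕ} (hp : p + 1 + k ≤ m) (h : m < j + 1 + p)
    (hm : j + 1 < m) :
    simpleNat cs j * turnWord cs k p = turnWord cs k p * simpleNat cs j := by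
  induction p with
  | zero => omega
  | succ p ih =>
    rcases Nat.lt_or_ge m (j + 1 + p) with h' | h'
    · rw [turnWord, ← mul_assoc, ← simpleNat_commute cs (by omega), mul_assoc,
        ih (by omega) h', mul_assoc]
    · obtain ⟨q, rfl⟩ : ∃ q, p = q + 1 := ⟨p - 1, by omega⟩
      obtain ⟨i, rfl⟩ : ∃ i, j = i + 1 := ⟨j - 1, by omega⟩
      have e1 : m - 2 - (q + 1) = i := by omega
      have e2 : m - 2 - q = i + 1 := by omega
      simp only [turnWord, e1, e2]
      rw [← mul_assoc, ← mul_assoc, ← simpleNat_braid_three cs (by omega), mul_assoc,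
        simpleNat_mul_turnWord_of_lt cs (by omega) (by omega)]
      simp only [mul_assoc]

/-- This is where the relation of order four enters: at the turn of the word it lets the last
generator pass through unchanged. -/
theorem simpleNat_last_mul_turnWord {k p : ℕ} (hp : p + 2 + k ≤ m) :
    simpleNat cs (m - 1) * turnWord cs k (p + 1) =
      turnWord cs k (p + 1) * simpleNat cs (m - 1) := by
  induction p with
  | zero =>
    obtain ⟨i, hi⟩ : ∃ i, m = k + i + 2 := ⟨m - k - 2, by omega⟩
    have e1 : m - 2 - 0 = k + i := by omega
    have e2 : m - 1 = k + i + 1 := by omega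
    have e3 : m - k = i + 1 + 1 := by omega
    simp only [turnWord, descWord, e1, e2, e3, ← Nat.add_assoc]
    rw [← mul_assoc, ← mul_assoc, ← mul_assoc, simpleNat_braid_four cs (by omega), mul_assoc,
      simpleNat_mul_descWord_of_gt cs (by omega)]
    simp only [mul_assoc]
  | succ p ih =>
    rw [turnWord, ← mul_assoc, ← simpleNat_commute cs (by omega), mul_assoc, ih (by omega),
      mul_assoc]

/-- The subgroup generated by the simple reflections with zero-based index at least `k`. -/
def tailSubgroup (k : ℕ) : Subgroup W := Subgroup.closure (simpleNat cs '' Set.Ici k)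

theorem simpleNat_mem_tailSubgroup {k j : ℕ} (h : k ≤ j) : simpleNat cs j ∈ tailSubgroup cs k :=
  Subgroup.subset_closure ⟨j, h, rfl⟩

/-- The union of the cosets of `tailSubgroup cs (k + 1)` of the words `descWord` and `turnWord`. -/
def cosetUnion (k : ℕ) : Set W :=
  {w | ∃ h ∈ tailSubgroup cs (k + 1), (∃ q, k + q ≤ m ∧ w = descWord cs k q * h) ∨
    (∃ p, p + 1 + k ≤ m ∧ w = turnWord cs k p * h)}

/-- A letter put in front of a representative either lengthens it to the next one, cancels its first
letter, or passes through it and is absorbed by `tailSubgroup cs (k + 1)`. -/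
theorem simpleNat_mul_mem_cosetUnion {k j : ℕ} (hk : k < m) (hj : k ≤ j) {w : W}
    (hw : w ∈ cosetUnion cs k) : simpleNat cs j * w ∈ cosetUnion cs k := by
  rcases Nat.lt_or_ge j m with hjm | hjm
  swap
  · rwa [simpleNat, dif_neg (by omega), one_mul]
  obtain ⟨h, hh, ⟨q, hq, rfl⟩ | ⟨p, hp, rfl⟩⟩ := hw
  · rcases lt_trichotomy j (k + q) with h1 | h1 | h1
    · rcases Nat.lt_or_ge (j + 1) (k + q) with h2 | h2
      · rcases Nat.lt_or_ge (j + 2) m with h3 | h3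
        · refine ⟨simpleNat cs (j + 1) * h, mul_mem (simpleNat_mem_tailSubgroup cs (by omega)) hh,
            Or.inl ⟨q, hq, ?_⟩⟩
          rw [← mul_assoc, simpleNat_mul_descWord_of_lt cs hj h2 h3, mul_assoc]
        · refine ⟨h, hh, Or.inr ⟨1, by omega, ?_⟩⟩
          rw [turnWord, turnWord, mul_assoc, show m - 2 - 0 = j by omega, show m - k = q by omega]
      · refine ⟨h, hh, Or.inl ⟨q - 1, by omega, ?_⟩⟩
        obtain ⟨p, rfl⟩ : ∃ p, q = p + 1 := ⟨q - 1, by omega⟩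
        rw [descWord, show j = k + p by omega, mul_assoc, simpleNat_mul_cancel, Nat.add_sub_cancel]
    · refine ⟨h, hh, Or.inl ⟨q + 1, by omega, ?_⟩⟩
      rw [descWord, h1, mul_assoc]
    · refine ⟨simpleNat cs j * h, mul_mem (simpleNat_mem_tailSubgroup cs (by omega)) hh,
        Or.inl ⟨q, hq, ?_⟩⟩
      rw [← mul_assoc, simpleNat_mul_descWord_of_gt cs h1, mul_assoc]
  · rcases Nat.eq_zero_or_pos p with rfl | hp0
    · rcases Nat.lt_or_ge (j + 2) m with h1 | h1
      · refine ⟨simpleNat cs (j + 1) * h, mul_mem (simpleNat_mem_tailSubgroup cs (by omega)) hh,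
            Or.inr ⟨0, hp, ?_⟩⟩
        rw [← mul_assoc, simpleNat_mul_turnWord_of_lt cs hj (by omega), mul_assoc]
      · rcases Nat.lt_or_ge (j + 1) m with h2 | h2
        · refine ⟨h, hh, Or.inr ⟨1, by omega, ?_⟩⟩
          rw [turnWord.eq_2, mul_assoc, show m - 2 - 0 = j by omega]
        · refine ⟨h, hh, Or.inl ⟨m - k - 1, by omega, ?_⟩⟩
          obtain ⟨i, hi⟩ : ∃ i, m - k = i + 1 := ⟨m - k - 1, by omega⟩
          rw [turnWord, hi, descWord, show j = k + i by omega, mul_assoc, simpleNat_mul_cancel,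
            Nat.add_sub_cancel]
    · obtain ⟨p, rfl⟩ : ∃ q, p = q + 1 := ⟨p - 1, by omega⟩
      rcases Nat.lt_or_ge (j + 2 + (p + 1)) m with h1 | h1
      · refine ⟨simpleNat cs (j + 1) * h, mul_mem (simpleNat_mem_tailSubgroup cs (by omega)) hh,
            Or.inr ⟨p + 1, hp, ?_⟩⟩
        rw [← mul_assoc, simpleNat_mul_turnWord_of_lt cs hj h1, mul_assoc]
      rcases h1.eq_or_lt with h1 | h1
      · refine ⟨h, hh, Or.inr ⟨p + 1 + 1, by omega, ?_⟩⟩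
        rw [turnWord.eq_2 _ _ (p + 1), mul_assoc, show m - 2 - (p + 1) = j by omega]
      rcases Nat.lt_or_ge m (j + 1 + (p + 1)) with h2 | h2
      · refine ⟨simpleNat cs j * h, mul_mem (simpleNat_mem_tailSubgroup cs (by omega)) hh,
          Or.inr ⟨p + 1, hp, ?_⟩⟩
        rcases Nat.lt_or_ge (j + 1) m with h3 | h3
        · rw [← mul_assoc, simpleNat_mul_turnWord_of_gt cs hp h2 h3, mul_assoc]
        · rw [← mul_assoc, show j = m - 1 by omega, simpleNat_last_mul_turnWord cs (by omega),
            mul_assoc]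
      · refine ⟨h, hh, Or.inr ⟨p, by omega, ?_⟩⟩
        rw [turnWord, show m - 2 - p = j by omega, mul_assoc, simpleNat_mul_cancel]

theorem tailSubgroup_subset_cosetUnion {k : ℕ} (hk : k < m) :
    (tailSubgroup cs k : Set W) ⊆ cosetUnion cs k := by
  intro w hw
  induction hw using Subgroup.closure_induction_left with
  | one => exact ⟨1, one_mem _, Or.inl ⟨0, by omega, by simp [descWord]⟩⟩
  | mul_left x hx y _ ih =>
    obtain ⟨j, hj, rfl⟩ := hx
    exact simpleNat_mul_mem_cosetUnion cs hk hj ih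
  | inv_mul_cancel x hx y _ ih =>
    obtain ⟨j, hj, rfl⟩ := hx
    rw [simpleNat_inv]
    exact simpleNat_mul_mem_cosetUnion cs hk hj ih

theorem kappa_apply_of_mem_tailSubgroup {k : ℕ} {w : W} (hw : w ∈ tailSubgroup cs (k + 1))
    (x : Fin (2 * m)) (hx : (x : ℕ) = k) : kappa cs w x = x := by
  induction hw using Subgroup.closure_induction with
  | mem y hy =>
    obtain ⟨j, hj, rfl⟩ := hy
    rw [Set.mem_Ici] at hj
    by_cases hjm : j < m
    · ext
      rw [kappa_simpleNat_apply_val cs hjm]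
      split_ifs <;> omega
    · rw [simpleNat, dif_neg hjm, map_one, Perm.one_apply]
  | one => simp
  | mul y z _ _ hy hz => rw [map_mul, Perm.mul_apply, hz, hy]
  | inv y _ hy => rw [map_inv, Perm.inv_eq_iff_eq, hy]

theorem kappa_descWord_apply {k q : ℕ} (hq : k + q ≤ m) (x : Fin (2 * m)) (hx : (x : ℕ) = k) :
    (kappa cs (descWord cs k q) x : ℕ) = k + q := by
  induction q with
  | zero => simpa [descWord] using hx
  | succ q ih =>
    rw [descWord, map_mul, Perm.mul_apply, kappa_simpleNat_apply_val cs (by omega),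
      ih (by omega), if_pos rfl, Nat.add_assoc]

theorem kappa_turnWord_apply {k p : ℕ} (hp : p + 1 + k ≤ m) (x : Fin (2 * m)) (hx : (x : ℕ) = k) :
    (kappa cs (turnWord cs k p) x : ℕ) = m + p := by
  induction p with
  | zero =>
    rw [turnWord, kappa_descWord_apply cs (by omega) x hx]
    omega
  | succ p ih =>
    rw [turnWord, map_mul, Perm.mul_apply, kappa_simpleNat_apply_val cs (by omega),
      ih (by omega)]
    split_ifs <;> omega

/-- The next tail subgroup fixes the letter `k`, while the representatives send it to `k + q` or `m
+ p`. An element acting trivially therefore has the trivial representative, and descends one step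
further. -/
theorem mem_tailSubgroup_of_kappa_eq_one {w : W} (hw : kappa cs w = 1) (k : ℕ) (hk : k ≤ m) :
    w ∈ tailSubgroup cs k := by
  induction k with
  | zero =>
    have h : (⊤ : Subgroup W) ≤ tailSubgroup cs 0 := by
      rw [← cs.subgroup_closure_range_simple, Subgroup.closure_le]
      rintro _ ⟨i, rfl⟩
      have := simpleNat_mem_tailSubgroup cs (Nat.zero_le (i : ℕ))
      rwa [simpleNat, dif_pos i.2] at this
    exact h (Subgroup.mem_top w)
  | succ k ih =>
    obtain ⟨h, hh, ⟨q, hq, rfl⟩ | ⟨p, hp, rfl⟩⟩ :=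
      tailSubgroup_subset_cosetUnion cs (by omega) (ih (by omega))
    all_goals
      let x : Fin (2 * m) := ⟨k, by omega⟩
      have hx := congrArg Fin.val (congrArg (fun g => g x) hw)
      simp only [map_mul, Perm.mul_apply, kappa_apply_of_mem_tailSubgroup cs hh x rfl] at hx
    · rw [kappa_descWord_apply cs hq x rfl] at hx
      obtain rfl : q = 0 := by simpa [x] using hx
      simpa [descWord] using hh
    · rw [kappa_turnWord_apply cs hp x rfl] at hx
      simp only [Perm.one_apply, x] at hx
      omega

theorem kappa_injective : Function.Injective (kappa cs) := by
  rw [injective_iff_map_eq_one]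
  intro w hw
  have h := mem_tailSubgroup_of_kappa_eq_one cs hw m le_rfl
  have h' : tailSubgroup cs m = ⊥ := by
    rw [tailSubgroup, Subgroup.closure_eq_bot_iff]
    rintro _ ⟨j, hj, rfl⟩
    simp [simpleNat, Nat.not_lt.2 hj]
  rwa [h', Subgroup.mem_bot] at h

end SymplecticDellac

namespace SymplecticDellac
open Equiv

variable {W : Type*} [Group W] {m : ℕ} (cs : CoxeterSystem (CoxeterMatrix.B m) W)

/-! ### Reflections and the image of `kappa` -/

theorem exists_isReflection_of_succ {a b : Fin (2 * m)} (h : (a : ℕ) + 1 = b) :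
    ∃ t, cs.IsReflection t ∧ kappa cs t = symSwap a b := by
  rcases Nat.lt_or_ge a m with ha | ha
  · refine ⟨cs.simple ⟨a, ha⟩, cs.isReflection_simple _, ?_⟩
    rw [kappa_simple, gen]
    congr 1
    exact Fin.ext h
  · refine ⟨cs.simple ⟨2 * m - 1 - b, by omega⟩, cs.isReflection_simple _, ?_⟩
    rw [kappa_simple, gen, ← symSwap_rev a b, symSwap_comm a.rev]
    congr 1 <;> ext <;> simp only [Fin.val_rev] <;> omega

theorem exists_isReflection_of_conj {h t : W} {a b : Fin (2 * m)}
    (ht : cs.IsReflection t)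
    (hht : kappa cs t = symSwap (kappa cs h a) (kappa cs h b)) (hh : h * h = 1) :
    ∃ t, cs.IsReflection t ∧ kappa cs t = symSwap a b := by
  refine ⟨h * t * h⁻¹, ht.conj h, ?_⟩
  have e (x : Fin (2 * m)) : kappa cs h (kappa cs h x) = x := by
    rw [← Perm.mul_apply, ← map_mul, hh, map_one, Perm.one_apply]
  rw [map_mul, map_mul, map_inv, hht, symSwap_conj (kappa_isSym cs h), e, e]

theorem exists_isReflection_of_lt {a b : Fin (2 * m)} (hab : a < b) :
    ∃ t, cs.IsReflection t ∧ kappa cs t = symSwap a b := by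
  induction hd : (b : ℕ) - a using Nat.strong_induction_on generalizing a b with
  | _ d ih =>
  rw [Fin.lt_def] at hab
  rcases Nat.eq_or_lt_of_le (Nat.succ_le_of_lt hab) with h1 | h1
  · exact exists_isReflection_of_succ cs h1
  -- The induction normally lowers `b` by one. If `a + b = 2m`, then `b - 1` is the mirror image of
  -- `a`, so that conjugation would also lower `a` and leave the distance unchanged; here `a` is
  -- raised instead.
  by_cases hs : (a : ℕ) + b = 2 * m
  · let c : Fin (2 * m) := ⟨a + 1, by omega⟩
    obtain ⟨g, hg, hga⟩ := exists_isReflection_of_succ cs (show (a : ℕ) + 1 = c from rfl)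
    have hb : symSwap a c b = b := by
      rw [symSwap_apply, if_neg, if_neg, if_neg, if_neg] <;>
        simp only [Fin.ext_iff, Fin.val_rev, c] <;> omega
    obtain ⟨t, ht, hta⟩ := ih (b - c) (by simp only [c]; omega)
      (show c < b by rw [Fin.lt_def]; simp only [c]; omega) rfl
    apply exists_isReflection_of_conj cs ht (h := g) _ hg.mul_self
    rw [hga, hb, symSwap_apply_left, hta]
  · let c : Fin (2 * m) := ⟨b - 1, by omega⟩
    obtain ⟨g, hg, hga⟩ := exists_isReflection_of_succ cs
      (show (c : ℕ) + 1 = b by simp only [c]; omega)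
    have key : ∃ t, cs.IsReflection t ∧ kappa cs t = symSwap (symSwap c b a) c := by
      have h2 : (symSwap c b a : ℕ) = if (a : ℕ) + b + 1 = 2 * m then (a : ℕ) + 1 else a := by
        rw [symSwap_apply]
        split_ifs <;> simp only [Fin.ext_iff, Fin.val_rev, c] at * <;> omega
      have h3 : symSwap c b a < c := by
        rw [Fin.lt_def, h2]; simp only [c]; split_ifs <;> omega
      exact ih _ (by rw [h2]; simp only [c]; split_ifs <;> omega) h3 rfl
    obtain ⟨t, ht, hta⟩ := key
    apply exists_isReflection_of_conj cs ht (h := g) _ hg.mul_self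
    rw [hga, symSwap_apply_right, hta]

theorem exists_isReflection {a b : Fin (2 * m)} (hab : a ≠ b) :
    ∃ t, cs.IsReflection t ∧ kappa cs t = symSwap a b := by
  rcases lt_or_gt_of_ne hab with h | h
  · exact exists_isReflection_of_lt cs h
  · rw [symSwap_comm]
    exact exists_isReflection_of_lt cs h

theorem exists_kappa_eq_symSwap {t : W} (ht : cs.IsReflection t) :
    ∃ a b, a < b ∧ kappa cs t = symSwap a b := by
  obtain ⟨w, i, rfl⟩ := ht
  have h : kappa cs (w * cs.simple i * w⁻¹) = symSwap (kappa cs w ⟨i, by omega⟩)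
      (kappa cs w ⟨i + 1, by omega⟩) := by
    rw [map_mul, map_mul, map_inv, kappa_simple, gen, symSwap_conj (kappa_isSym cs w)]
  have hne : kappa cs w ⟨i, by omega⟩ ≠ kappa cs w ⟨i + 1, by omega⟩ := by
    simp [(kappa cs w).injective.eq_iff]
  rcases lt_or_gt_of_ne hne with h1 | h1
  · exact ⟨_, _, h1, h⟩
  · exact ⟨_, _, h1, by rw [h, symSwap_comm]⟩

/-- Sorting by symmetric transpositions. The swap that repairs position `k` leaves the earlier fixed
letters alone, because their mirror images lie in the upper half and are fixed too. -/
theorem exists_kappa_mul_fixes {σ : Perm (Fin (2 * m))} (hσ : IsSym σ) (k : ℕ) (hk : k ≤ m) :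
    ∃ w, ∀ x : Fin (2 * m), (x : ℕ) < k → (kappa cs w * σ) x = x := by
  induction k with
  | zero => exact ⟨1, fun x hx => by omega⟩
  | succ k ih =>
    obtain ⟨w, hw⟩ := ih (by omega)
    have hs : IsSym (kappa cs w * σ) := (kappa_isSym cs w).mul hσ
    set ρ := kappa cs w * σ with hρ
    let z : Fin (2 * m) := ⟨k, by omega⟩
    by_cases hz : ρ z = z
    · refine ⟨w, fun x hx => ?_⟩
      rcases Nat.lt_succ_iff_lt_or_eq.1 hx with h | h
      · exact hw x h
      · rwa [show x = z from Fin.ext h]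
    · obtain ⟨t, -, ht⟩ := exists_isReflection cs (Ne.symm hz)
      refine ⟨t * w, fun x hx => ?_⟩
      rw [map_mul, mul_assoc, ← hρ, Perm.mul_apply, ht]
      rcases Nat.lt_succ_iff_lt_or_eq.1 hx with h | h
      · have hx' := hw x h
        have hxz : x ≠ z := fun e => by rw [e] at h; exact lt_irrefl _ h
        have hxz' : x.rev ≠ z := fun e => by
          have := congrArg Fin.val e
          simp only [Fin.val_rev, z] at this
          omega
        have h4 : x ≠ z.rev := fun e => hxz' (by rw [e, Fin.rev_rev])
        rw [hx', symSwap_apply, if_neg hxz, if_neg, if_neg h4, if_neg]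
        · intro e
          apply hxz'
          apply ρ.injective
          rw [hs, hx', e, Fin.rev_rev]
        · intro e
          exact hxz (ρ.injective (hx'.trans e))
      · rw [show x = z from Fin.ext h, symSwap_apply_right]

theorem range_kappa : Set.range (kappa cs) = {σ | IsSym σ} := by
  ext σ
  constructor
  · rintro ⟨w, rfl⟩
    exact kappa_isSym cs w
  · intro hσ
    obtain ⟨w, hw⟩ := exists_kappa_mul_fixes cs hσ m le_rfl
    refine ⟨w⁻¹, ?_⟩
    rw [map_inv, inv_eq_iff_mul_eq_one]
    have hs : IsSym (kappa cs w * σ) := (kappa_isSym cs w).mul hσ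
    ext1 x
    rcases Nat.lt_or_ge x m with h | h
    · exact hw x h
    · have h1 := hw x.rev (by rw [Fin.val_rev]; omega)
      rw [hs] at h1
      exact Fin.rev_injective h1

/-! ### Lengths -/

theorem gen_apply_eq_of_inverts (i : Fin m) {c d : Fin (2 * m)} (hcd : c < d)
    (h : gen m i d < gen m i c) : gen m i c = d := by
  ext
  rw [Fin.lt_def, gen_apply_val, gen_apply_val] at h
  rw [Fin.lt_def] at hcd
  rw [gen_apply_val]
  split_ifs at h ⊢ <;> omega

/-- Reading the word from the right, some letter must first reverse the images of `a` and `b`. That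
letter is then the symmetric swap of those two images, and conjugating it back by the suffix gives
`t`, by injectivity of `kappa`. -/
theorem mem_rightInvSeq_of_inverts {a b : Fin (2 * m)} (hab : a < b) {t : W}
    (ht : kappa cs t = symSwap a b) (ω : List (Fin m))
    (h : kappa cs (cs.wordProd ω) b < kappa cs (cs.wordProd ω) a) : t ∈ cs.rightInvSeq ω := by
  induction ω with
  | nil =>
    rw [cs.wordProd_nil, map_one] at h
    exact absurd h (not_lt.2 hab.le)
  | cons i ω ih =>
    rw [CoxeterSystem.rightInvSeq]
    rcases lt_or_ge (kappa cs (cs.wordProd ω) b) (kappa cs (cs.wordProd ω) a) with h1 | h1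
    · exact List.mem_cons_of_mem _ (ih h1)
    · have h2 : kappa cs (cs.wordProd ω) a < kappa cs (cs.wordProd ω) b :=
        lt_of_le_of_ne h1 fun e => hab.ne ((kappa cs (cs.wordProd ω)).injective e)
      rw [cs.wordProd_cons, map_mul, Perm.mul_apply, Perm.mul_apply, kappa_simple] at h
      have h3 : gen m i = _ := symSwap_eq_of_apply (gen_apply_eq_of_inverts i h2 h) h2.ne
      have h4 : t = (cs.wordProd ω)⁻¹ * cs.simple i * cs.wordProd ω := by
        apply kappa_injective cs
        have h5 := symSwap_conj (kappa_isSym cs (cs.wordProd ω)⁻¹)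
          (kappa cs (cs.wordProd ω) a) (kappa cs (cs.wordProd ω) b)
        rw [← h3] at h5
        simp only [map_mul, map_inv, Perm.inv_def, symm_apply_apply, symm_symm] at h5 ⊢
        rw [ht, kappa_simple, h5]
      rw [h4]
      exact List.mem_cons_self

theorem length_mul_lt_of_inverts {a b : Fin (2 * m)} (hab : a < b) {w t : W}
    (ht : kappa cs t = symSwap a b) (h : kappa cs w b < kappa cs w a) :
    cs.length (w * t) < cs.length w := by
  obtain ⟨ω, hω, rfl⟩ := cs.exists_isReduced w
  exact (cs.isRightInversion_of_mem_rightInvSeq hω (mem_rightInvSeq_of_inverts cs hab ht ω h)).2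

theorem length_lt_length_mul_iff {a b : Fin (2 * m)} (hab : a < b) {w t : W}
    (ht : kappa cs t = symSwap a b) :
    cs.length w < cs.length (w * t) ↔ kappa cs w a < kappa cs w b := by
  constructor
  · intro h
    by_contra h1
    have h2 : kappa cs w b < kappa cs w a :=
      lt_of_le_of_ne (not_lt.1 h1) fun e => hab.ne' ((kappa cs w).injective e)
    exact absurd (length_mul_lt_of_inverts cs hab ht h2) (not_lt.2 h.le)
  · intro h
    have htt : t * t = 1 := by
      apply kappa_injective cs
      rw [map_mul, ht, symSwap_mul_self, map_one]
    have h1 := length_mul_lt_of_inverts cs hab (w := w * t) ht (by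
      rw [map_mul, Perm.mul_apply, Perm.mul_apply, ht, symSwap_apply_left, symSwap_apply_right]
      exact h)
    rwa [mul_assoc, htt, mul_one] at h1

theorem group_finite {W : Type*} [Group W] (cs : CoxeterSystem (CoxeterMatrix.B m) W) :
    Finite W := Finite.of_injective _ (kappa_injective cs)

/-! ### Minimal coset representatives -/

/-- The permutation is increasing on each of the pairs `{2k, 2k + 1}`. -/
def PairIncreasing (σ : Perm (Fin (2 * m))) : Prop :=
  ∀ x y : Fin (2 * m), Even (x : ℕ) → (y : ℕ) = x + 1 → σ x < σ y

variable {n : ℕ} (cs : CoxeterSystem (CoxeterMatrix.B (2 * n)) W)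

theorem pairIncreasing_of_mem_minReps {w : W} (hw : w ∈ minReps cs (J n)) :
    PairIncreasing (kappa cs w) := by
  have key : ∀ x y : Fin (2 * (2 * n)), Even (x : ℕ) → (y : ℕ) = x + 1 → (x : ℕ) < 2 * n →
      kappa cs w x < kappa cs w y := by
    intro x y hx hy hxn
    have hk : kappa cs (cs.simple ⟨x, hxn⟩) = symSwap x y := by
      rw [kappa_simple, gen]
      congr 1
      exact Fin.ext hy.symm
    rw [← length_lt_length_mul_iff cs (Fin.lt_def.2 (by omega)) hk]
    refine lt_of_le_of_ne (hw _ (Subgroup.subset_closure ⟨⟨x, hxn⟩, hx, rfl⟩)) ?_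
    exact (cs.length_mul_simple_ne w _).symm
  intro x y hx hy
  rcases Nat.lt_or_ge x (2 * n) with h | h
  · exact key x y hx hy h
  -- Pairs in the upper half are mirror images of pairs in the lower half, where a generator in `J`
  -- is available.
  · have h1 := key y.rev x.rev (by rw [Fin.val_rev]; rw [Nat.even_iff] at hx ⊢; omega)
      (by simp only [Fin.val_rev]; omega) (by rw [Fin.val_rev]; omega)
    rwa [kappa_isSym, kappa_isSym, Fin.rev_lt_rev] at h1

theorem kappa_apply_div_two_of_mem_parabolic {u : W} (hu : u ∈ parabolic cs (J n))
    (x : Fin (2 * (2 * n))) : (kappa cs u x : ℕ) / 2 = x / 2 := by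
  induction hu using Subgroup.closure_induction generalizing x with
  | mem y hy =>
    obtain ⟨j, hj, rfl⟩ := hy
    obtain ⟨k, hk⟩ : Even (j : ℕ) := hj
    rw [kappa_simple, gen_apply_val]
    split_ifs <;> omega
  | one => simp
  | mul y z _ _ hy hz => rw [map_mul, Perm.mul_apply, hy, hz]
  | inv y _ hy =>
    rw [map_inv]
    conv_rhs => rw [← apply_symm_apply (kappa cs y) x, hy]
    rfl

/-- For the converse, a shortest element `w * u` of the coset is pair-increasing by the forward
direction. Since `u` preserves every pair and both `w` and `w * u` increase on it, `u` fixes all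
letters. -/
theorem mem_minReps_iff {w : W} : w ∈ minReps cs (J n) ↔ PairIncreasing (kappa cs w) := by
  refine ⟨pairIncreasing_of_mem_minReps cs, fun hw => ?_⟩
  obtain ⟨u, hu, hmin⟩ := (InvImage.wf (fun u => cs.length (w * u)) Nat.lt_wfRel.wf).has_min
    (parabolic cs (J n) : Set W) ⟨1, one_mem _⟩
  have hmin' : ∀ v ∈ parabolic cs (J n), cs.length (w * u) ≤ cs.length (w * v) :=
    fun v hv => not_lt.1 (hmin v hv)
  have hwu : PairIncreasing (kappa cs (w * u)) := by
    apply pairIncreasing_of_mem_minReps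
    intro v hv
    rw [mul_assoc]
    exact hmin' _ (mul_mem hu hv)
  have hpair : ∀ x y : Fin (2 * (2 * n)), Even (x : ℕ) → (y : ℕ) = x + 1 →
      kappa cs u x = x ∧ kappa cs u y = y := by
    intro x y hx hy
    have h1 := kappa_apply_div_two_of_mem_parabolic cs hu x
    have h2 := kappa_apply_div_two_of_mem_parabolic cs hu y
    have h3 := hwu x y hx hy
    have h4 := hw x y hx hy
    have h5 : kappa cs u x ≠ kappa cs u y := fun e => by
      have := congrArg Fin.val ((kappa cs u).injective e)
      omega
    rw [Nat.even_iff] at hx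
    by_cases h : kappa cs u x = x
    · refine ⟨h, ?_⟩
      rw [h, ne_eq, Fin.ext_iff] at h5
      exact Fin.ext (by omega)
    · exfalso
      have h6 : kappa cs u x = y := by
        rw [Fin.ext_iff] at h ⊢; omega
      have h7 : kappa cs u y = x := by
        rw [h6, ne_eq, Fin.ext_iff] at h5
        exact Fin.ext (by omega)
      rw [map_mul, Perm.mul_apply, Perm.mul_apply, h6, h7] at h3
      exact absurd h3 (not_lt.2 h4.le)
  have hu1 : u = 1 := by
    apply kappa_injective cs
    rw [map_one]
    ext1 x
    rcases Nat.even_or_odd (x : ℕ) with h | h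
    · exact (hpair x ⟨x + 1, by rw [Nat.even_iff] at h; omega⟩ h rfl).1
    · rw [Nat.odd_iff] at h
      refine (hpair ⟨x - 1, by omega⟩ x ?_ ?_).2
      · rw [Nat.even_iff]; dsimp only; omega
      · dsimp only; omega
  intro v hv
  have := hmin' v hv
  rwa [hu1, mul_one] at this

end SymplecticDellac

namespace SymplecticDellac
open Equiv

variable {W : Type*} [Group W] {m : ℕ}

/-! ### The Bruhat interval below the shuffle permutation -/

/-- The marks of the permutation satisfy the upper bounds for the two rows merged into one row of a
Dellac configuration. -/
def IsBounded (σ : Perm (Fin (2 * m))) : Prop := ∀ x, (σ x : ℕ) ≤ m + x / 2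

/-- The upper bound at the mirror position is the lower bound here. -/
theorem IsBounded.div_two_le {σ : Perm (Fin (2 * m))} (hb : IsBounded σ) (hs : IsSym σ)
    (x : Fin (2 * m)) : (x : ℕ) / 2 ≤ σ x := by
  have h := hb x.rev
  rw [hs] at h
  simp only [Fin.val_rev] at h
  omega

/-- The product puts the larger value `σ b` at the earlier position `a`, so its bounds at `a` and at
`b.rev` are the strictest ones needed for `σ`. -/
theorem IsBounded.of_mul_symSwap {σ : Perm (Fin (2 * m))} (hs : IsSym σ) {a b : Fin (2 * m)}
    (hab : a < b) (hlt : σ a < σ b) (hb : IsBounded (σ * symSwap a b)) : IsBounded σ := by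
  intro x
  have ha := hb a
  have hrb := hb b.rev
  have hx := hb x
  have e : symSwap a b b.rev = a.rev := by
    rw [symSwap_isSym a b b, symSwap_apply_right]
  rw [Perm.mul_apply, symSwap_apply_left] at ha
  rw [Perm.mul_apply, e, hs] at hrb
  rw [Perm.mul_apply, symSwap_apply] at hx
  rw [Fin.lt_def] at hab hlt
  simp only [Fin.val_rev] at hrb
  split_ifs at hx with h1 h2 h3 h4
  · subst h1; omega
  · subst h2; omega
  · subst h3; rw [hs]; simp only [Fin.val_rev]; omega
  · subst h4; rw [hs]; simp only [Fin.val_rev]; omega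
  · exact hx

theorem IsBounded.of_bruhatLE (cs : CoxeterSystem (CoxeterMatrix.B m) W) {u v : W}
    (h : BruhatLE cs u v) (hv : IsBounded (kappa cs v)) : IsBounded (kappa cs u) := by
  induction h using Relation.ReflTransGen.head_induction_on with
  | refl => exact hv
  | head h _ ih =>
    obtain ⟨t, ht, rfl, hl⟩ := h
    obtain ⟨a, b, hab, hk⟩ := exists_kappa_eq_symSwap cs ht
    rw [length_lt_length_mul_iff cs hab hk] at hl
    rw [map_mul, hk] at ih
    exact ih.of_mul_symSwap (kappa_isSym cs _) hab hl

/-- If the value at an odd position `a` is moved to the nearest larger position `b` whose value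
lies strictly above it and weakly below `v`, it respects the lower bound of the new position. -/
theorem div_two_le_of_nearest {σ : Perm (Fin (2 * m))} (hp : PairIncreasing σ)
    (hl : ∀ x : Fin (2 * m), (x : ℕ) / 2 ≤ σ x) (hb : IsBounded σ) {k : ℕ} {a b : Fin (2 * m)}
    (ha : (a : ℕ) = 2 * k + 1) (hab : a < b) (hac : (σ a : ℕ) < m + k)
    (hnear : ∀ x, a < x → x < b → σ x < σ a ∨ m + k < σ x) : (b : ℕ) / 2 ≤ σ a := by
  rw [Fin.lt_def] at hab
  -- Count the values on the complete pairs from that of `a` up to, but excluding, that of `b`. They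
  -- are either at most `σ a` or above `m + k`, and the bounds confine them to two intervals;
  -- comparing sizes gives `2(b/2 - k) ≤ (σ a + 1 - k) + (b/2 - k - 1)`, which is the claim.
  have hsub : ((Finset.Ico (2 * k) (2 * (b / 2))).attachFin
      (fun x hx => by rw [Finset.mem_Ico] at hx; omega)).image (fun x => (σ x : ℕ)) ⊆
      Finset.Icc k (σ a) ∪ Finset.Ioo (m + k) (m + b / 2) := by
    intro y hy
    obtain ⟨x, hx, rfl⟩ := Finset.mem_image.1 hy
    rw [Finset.mem_attachFin, Finset.mem_Ico] at hx
    rw [Finset.mem_union, Finset.mem_Icc, Finset.mem_Ioo]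
    have h1 := hl x
    have h2 := hb x
    rcases lt_trichotomy x a with h | h | h
    · have := hp x a (by rw [Fin.lt_def] at h; rw [Nat.even_iff]; omega)
        (by rw [Fin.lt_def] at h; omega)
      rw [Fin.lt_def] at this
      omega
    · subst h; omega
    · rcases hnear x h (by rw [Fin.lt_def]; omega) with h3 | h3
      · rw [Fin.lt_def] at h3; omega
      · omega
  have hcard := Finset.card_le_card hsub
  have hinj : Function.Injective fun x => (σ x : ℕ) := Fin.val_injective.comp σ.injective
  rw [Finset.card_image_of_injective _ hinj,
    Finset.card_attachFin, Nat.card_Ico] at hcard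
  have h2 := Finset.card_union_le (Finset.Icc k (σ a : ℕ)) (Finset.Ioo (m + k) (m + b / 2))
  rw [Nat.card_Icc, Nat.card_Ioo] at h2
  have h3 := hl a
  omega

/-- Take `a` to be the first odd position below its maximal value `m + k`, and `b` the first later
position whose value lies above `σ a` and at most at `m + k`. -/
theorem exists_nearest {σ : Perm (Fin (2 * m))} (hp : PairIncreasing σ) (hb : IsBounded σ)
    (hne : ∃ x : Fin (2 * m), Odd (x : ℕ) ∧ (σ x : ℕ) ≠ m + x / 2) :
    ∃ (k : ℕ) (a b : Fin (2 * m)), (a : ℕ) = 2 * k + 1 ∧ a < b ∧ σ a < σ b ∧ (σ b : ℕ) ≤ m + k ∧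
      ∀ x, a < x → x < b → σ x < σ a ∨ m + k < σ x := by
  obtain ⟨a, ⟨hao, han⟩, hamin⟩ := WellFounded.has_min (wellFounded_lt (α := Fin (2 * m)))
    {x : Fin (2 * m) | Odd (x : ℕ) ∧ (σ x : ℕ) ≠ m + x / 2} hne
  obtain ⟨k, hk⟩ := hao
  have hba := hb a
  have hlt : (σ a : ℕ) < m + k := by omega
  let v : Fin (2 * m) := ⟨m + k, by omega⟩
  let p := σ.symm v
  have hpv : (σ p : ℕ) = m + k := by simp [p, v]
  -- The value `m + k` cannot occur before `a`: at an even position its partner would exceed the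
  -- bound, and odd positions before `a` carry smaller maximal values. So `p` is a candidate for
  -- `b`.
  have hap : a < p := by
    by_contra hcon
    rcases (not_lt.1 hcon).eq_or_lt with h | h
    · rw [h] at hpv; omega
    · rcases Nat.even_or_odd (p : ℕ) with h1 | h1
      · rw [Fin.lt_def] at h
        let q : Fin (2 * m) := ⟨p + 1, by omega⟩
        have h2 := hp p q h1 rfl
        have h3 := hb q
        rw [Fin.lt_def] at h2
        rw [Nat.even_iff] at h1
        simp only [q] at h2 h3
        omega
      · have h2 : (σ p : ℕ) = m + p / 2 := by
          by_contra h2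
          exact hamin p ⟨h1, h2⟩ h
        rw [Nat.odd_iff] at h1
        rw [Fin.lt_def] at h
        omega
  obtain ⟨b, ⟨hab, hσ, hσv⟩, hbmin⟩ := WellFounded.has_min (wellFounded_lt (α := Fin (2 * m)))
    {x : Fin (2 * m) | a < x ∧ σ a < σ x ∧ (σ x : ℕ) ≤ m + k}
    ⟨p, hap, by rw [Fin.lt_def]; omega, hpv.le⟩
  refine ⟨k, a, b, hk, hab, hσ, hσv, fun x hax hxb => ?_⟩
  by_contra! hcon
  exact hbmin x ⟨hax, lt_of_le_of_ne hcon.1 fun e => hax.ne (σ.injective e), hcon.2⟩ hxb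

theorem isBounded_mul_symSwap {σ : Perm (Fin (2 * m))} (hs : IsSym σ) (hb : IsBounded σ)
    {a b : Fin (2 * m)} (hσ : σ a < σ b) (hup : (σ b : ℕ) ≤ m + a / 2)
    (hlow : (b : ℕ) / 2 ≤ σ a) : IsBounded (σ * symSwap a b) := by
  intro x
  rw [Perm.mul_apply, symSwap_apply]
  rw [Fin.lt_def] at hσ
  have hx := hb x
  split_ifs with h1 h2 h3 h4
  · subst h1; exact hup
  · subst h2; omega
  · subst h3; rw [hs] at hx ⊢; simp only [Fin.val_rev] at hx ⊢; omega
  · subst h4; rw [hs] at hx ⊢; simp only [Fin.val_rev] at hx ⊢; omega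
  · exact hx

theorem pairIncreasing_mul_symSwap {n : ℕ} {σ : Perm (Fin (2 * (2 * n)))} (hs : IsSym σ)
    (hp : PairIncreasing σ) {a b : Fin (2 * (2 * n))} (ha : Odd (a : ℕ)) (hab : a < b)
    (hσ : σ a < σ b)
    (hnear : ∀ x, a < x → x < b → σ x < σ a ∨ σ b < σ x) : PairIncreasing (σ * symSwap a b) := by
  have hT : IsSym (σ * symSwap a b) := hs.mul (symSwap_isSym a b)
  rw [Nat.odd_iff] at ha
  rw [Fin.lt_def] at hab
  -- the pairs that contain `a` or `b`
  have key : ∀ x y : Fin (2 * (2 * n)), Even (x : ℕ) → (y : ℕ) = x + 1 → y = a ∨ x = b ∨ y = b →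
      (σ * symSwap a b) x < (σ * symSwap a b) y := by
    intro x y hx hy h
    have hxy := hp x y hx hy
    rw [Nat.even_iff] at hx
    rw [Perm.mul_apply, Perm.mul_apply]
    rcases h with rfl | rfl | rfl
    · rw [symSwap_apply_left, symSwap_apply, if_neg (by rw [Fin.ext_iff]; omega),
        if_neg (by rw [Fin.ext_iff]; omega),
        if_neg (by simp only [Fin.ext_iff, Fin.val_rev]; omega)]
      split_ifs with h1
      -- Here `a - 1` is the mirror image of `b`, so the swap moves it as well; the inequality
      -- becomes that of the pair `(a.rev, b)`.
      · apply hp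
        · rw [Nat.even_iff, Fin.val_rev]; omega
        · subst h1
          simp only [Fin.val_rev] at hy ⊢; omega
      · exact hxy.trans hσ
    · rw [symSwap_apply_right, symSwap_apply, if_neg (by rw [Fin.ext_iff]; omega),
        if_neg (by rw [Fin.ext_iff]; omega),
        if_neg (by simp only [Fin.ext_iff, Fin.val_rev]; omega),
        if_neg (by simp only [Fin.ext_iff, Fin.val_rev]; omega)]
      exact hσ.trans hxy
    · rw [symSwap_apply_right, symSwap_apply, if_neg (by rw [Fin.ext_iff]; omega),
        if_neg (by rw [Fin.ext_iff]; omega)]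
      split_ifs with h1 h2
      · apply hp
        · rw [Nat.even_iff, Fin.val_rev]; omega
        · subst h1
          simp only [Fin.val_rev] at hy ⊢; omega
      -- This would make the two central positions a pair, which is impossible because half the
      -- number of letters, `2n`, is even.
      · subst h2
        simp only [Fin.val_rev] at hx hy
        omega
      · rcases hnear x (by rw [Fin.lt_def]; omega) (by rw [Fin.lt_def]; omega) with h3 | h3
        · exact h3
        · exact absurd h3 (not_lt.2 hxy.le)
  intro x y hx hy
  by_cases h1 : y = a ∨ x = b ∨ y = b
  · exact key x y hx hy h1
  have hx' := Nat.even_iff.1 hx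
  by_cases h2 : x.rev = a ∨ y.rev = b ∨ x.rev = b
  · have h3 := key y.rev x.rev (by rw [Nat.even_iff, Fin.val_rev]; omega)
      (by simp only [Fin.val_rev]; omega) h2
    rwa [hT, hT, Fin.rev_lt_rev] at h3
  have hfix : ∀ z : Fin (2 * (2 * n)), z ≠ a → z ≠ b → z.rev ≠ a → z.rev ≠ b →
      symSwap a b z = z := by
    intro z h3 h4 h5 h6
    rw [symSwap_apply, if_neg h3, if_neg h4, if_neg fun e => h5 (by rw [e, Fin.rev_rev]),
      if_neg fun e => h6 (by rw [e, Fin.rev_rev])]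
  rw [Perm.mul_apply, Perm.mul_apply, hfix, hfix]
  · exact hp x y hx hy
  · tauto
  · tauto
  · rw [ne_eq, Fin.ext_iff, Fin.val_rev]; omega
  · tauto
  · rw [ne_eq, Fin.ext_iff]; omega
  · tauto
  · tauto
  · tauto

theorem exists_larger {n : ℕ} {σ : Perm (Fin (2 * (2 * n)))} (hs : IsSym σ)
    (hp : PairIncreasing σ) (hb : IsBounded σ)
    (hne : ∃ x : Fin (2 * (2 * n)), Odd (x : ℕ) ∧ (σ x : ℕ) ≠ 2 * n + x / 2) :
    ∃ a b, a < b ∧ σ a < σ b ∧ PairIncreasing (σ * symSwap a b) ∧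
      IsBounded (σ * symSwap a b) := by
  obtain ⟨k, a, b, ha, hab, hσ, hσv, hnear⟩ := exists_nearest hp hb hne
  refine ⟨a, b, hab, hσ, ?_, ?_⟩
  · refine pairIncreasing_mul_symSwap hs hp ⟨k, ha⟩ hab hσ fun x hx hxb => ?_
    refine (hnear x hx hxb).imp id fun h => ?_
    rw [Fin.lt_def]
    omega
  · refine isBounded_mul_symSwap hs hb hσ (by omega) ?_
    rw [Fin.lt_def] at hσ
    exact div_two_le_of_nearest hp (hb.div_two_le hs) hb ha hab (by omega) hnear

/-- The values of the permutation `1, m + 1, 2, m + 2, …, m, 2m` (in zero-based form). -/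
def IsShuffle (τ : Perm (Fin (2 * m))) : Prop :=
  ∀ x, (τ x : ℕ) = if Even (x : ℕ) then (x : ℕ) / 2 else m + x / 2

theorem IsShuffle.eq {σ τ : Perm (Fin (2 * m))} (hσ : IsShuffle σ) (hτ : IsShuffle τ) : σ = τ := by
  ext x
  rw [hσ, hτ]

theorem IsShuffle.isBounded {τ : Perm (Fin (2 * m))} (hτ : IsShuffle τ) : IsBounded τ := by
  intro x
  rw [hτ]
  split_ifs <;> omega

theorem isShuffle_of_odd {σ : Perm (Fin (2 * m))} (hs : IsSym σ)
    (h : ∀ x : Fin (2 * m), Odd (x : ℕ) → (σ x : ℕ) = m + x / 2) : IsShuffle σ := by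
  intro x
  split_ifs with hx
  · have h1 := h x.rev (by rw [Nat.even_iff] at hx; rw [Nat.odd_iff, Fin.val_rev]; omega)
    rw [hs] at h1
    rw [Nat.even_iff] at hx
    simp only [Fin.val_rev] at h1
    omega
  · exact h x (Nat.not_even_iff_odd.1 hx)

/-- Each application of `exists_larger` is one Bruhat step upwards. It can fail only when all odd
positions carry their maximal values, and then symmetry forces the shuffle. -/
theorem bruhatLE_of_isBounded {n : ℕ} (cs : CoxeterSystem (CoxeterMatrix.B (2 * n)) W) {w t : W}
    (ht : IsShuffle (kappa cs t)) (hp : PairIncreasing (kappa cs w))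
    (hb : IsBounded (kappa cs w)) : BruhatLE cs w t := by
  have := group_finite cs
  obtain ⟨B, hB⟩ := (Set.finite_range cs.length).bddAbove
  induction hd : B - cs.length w using Nat.strong_induction_on generalizing w with
  | _ d ih =>
  by_cases hne : ∃ x : Fin (2 * (2 * n)), Odd (x : ℕ) ∧ (kappa cs w x : ℕ) ≠ 2 * n + x / 2
  · obtain ⟨a, b, hab, hσ, hp', hb'⟩ := exists_larger (kappa_isSym cs w) hp hb hne
    obtain ⟨u, hu, hk⟩ := exists_isReflection cs hab.ne
    have hl := (length_lt_length_mul_iff cs hab hk).2 hσ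
    rw [← hk, ← map_mul] at hp' hb'
    have hB' := hB ⟨w * u, rfl⟩
    exact Relation.ReflTransGen.head ⟨u, hu, rfl, hl⟩ (ih _ (by omega) hp' hb' rfl)
  · push Not at hne
    rw [kappa_injective cs ((isShuffle_of_odd (kappa_isSym cs w) hne).eq ht)]
    exact Relation.ReflTransGen.refl

theorem mem_minRepsLE_iff {n : ℕ} (cs : CoxeterSystem (CoxeterMatrix.B (2 * n)) W) {w t : W}
    (ht : IsShuffle (kappa cs t)) : w ∈ minRepsLE cs (J n) t ↔
      PairIncreasing (kappa cs w) ∧ IsBounded (kappa cs w) := by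
  rw [minRepsLE, Set.mem_ofPred_eq, mem_minReps_iff]
  exact ⟨fun h => ⟨h.1, ht.isBounded.of_bruhatLE cs h.2⟩,
    fun h => ⟨h.1, bruhatLE_of_isBounded cs ht h.1 h.2⟩⟩

end SymplecticDellac

namespace SymplecticDellac
open Equiv

variable {W : Type*} [Group W] {m : ℕ}

/-! ### The shuffle permutation as a product of simple reflections -/

theorem downFrom_succ (m : ℕ) : downFrom (m + 1) = (m + 1) :: downFrom m := by
  simp [downFrom, List.range'_concat, Nat.add_comm]

section Blocks

variable {N L : ℕ} {g : ℕ → Perm (Fin N)}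

theorem ascBlock_apply
    (hg : ∀ i, 1 ≤ i → i < L → ∀ x : Fin N, (x : ℕ) < L →
      (g i x : ℕ) = if (x : ℕ) + 1 = i then i else if (x : ℕ) = i then i - 1 else x)
    {k q : ℕ} (hk : 1 ≤ k) (hq : k + q ≤ L) (x : Fin N) (hx : (x : ℕ) < L) :
    ((((List.range q).map fun a => g (k + a)).prod) x : ℕ) =
      if (x : ℕ) + 1 = k + q then k - 1 else if k ≤ (x : ℕ) + 1 ∧ (x : ℕ) + 1 < k + q then x + 1
      else x := by
  induction q generalizing x with
  | zero =>
    simp only [List.range_zero, List.map_nil, List.prod_nil, Perm.one_apply]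
    split_ifs <;> omega
  | succ q ih =>
    have h1 := hg (k + q) (by omega) (by omega) x hx
    rw [List.range_succ, List.map_append, List.prod_append, List.map_singleton,
      List.prod_singleton, Perm.mul_apply, ih (by omega) _ (by rw [h1]; split_ifs <;> omega), h1]
    split_ifs <;> omega

/-- Only the action of `g i` on letters below `L` is prescribed, so the lemma serves both the
adjacent transpositions of all `2m` letters and the images of the `r_i`, which act like them on the
lower half only. -/
theorem shuffleProd_apply
    (hg : ∀ i, 1 ≤ i → i < L → ∀ x : Fin N, (x : ℕ) < L →
      (g i x : ℕ) = if (x : ℕ) + 1 = i then i else if (x : ℕ) = i then i - 1 else x)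
    {k : ℕ} (hk : 2 * k ≤ L) (x : Fin N) (hx : (x : ℕ) < L) :
    ((((downFrom k).map fun k => ((List.range (k - 1)).map fun a => g (k + a)).prod).prod) x : ℕ) =
      if (x : ℕ) < 2 * k then if Even (x : ℕ) then (x : ℕ) / 2 else k + x / 2 else x := by
  induction k with
  | zero => simp [downFrom]
  | succ k ih =>
    have ih := ih (by omega)
    rw [downFrom_succ, List.map_cons, List.prod_cons, Perm.mul_apply,
      ascBlock_apply hg (by omega) (by omega) _ (by rw [ih]; split_ifs <;> omega), ih]
    simp only [Nat.even_iff]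
    split_ifs <;> omega

end Blocks

theorem s_apply_val {N i : ℕ} (h1 : 1 ≤ i) (h2 : i < N) (x : Fin N) :
    (s N i x : ℕ) = if (x : ℕ) + 1 = i then i else if (x : ℕ) = i then i - 1 else x := by
  rw [s, dif_pos ⟨h1, h2⟩, swap_apply_def]
  simp only [Fin.ext_iff, apply_ite Fin.val]
  split_ifs <;> omega

theorem isShuffle_tau (m : ℕ) : IsShuffle (tau m) := by
  intro x
  rw [tau, shuffleProd_apply (fun i h1 h2 x _ => s_apply_val h1 h2 x) le_rfl x x.2, if_pos x.2]

variable {n : ℕ} (cs : CoxeterSystem (CoxeterMatrix.B (2 * n)) W)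

theorem kappa_r {i : ℕ} (h1 : 1 ≤ i) (h2 : i ≤ 2 * n) :
    kappa cs (r cs i) = gen (2 * n) ⟨i - 1, by omega⟩ := by
  rw [r, dif_pos ⟨h1, h2⟩, kappa_simple]

theorem kappaGen_eq_gen {i : ℕ} (h1 : 1 ≤ i) (h2 : i ≤ 2 * n) :
    kappaGen n i = gen (2 * n) ⟨i - 1, by omega⟩ := by
  ext x
  rw [gen_apply_val, kappaGen]
  dsimp only
  by_cases h : i = 2 * n
  · rw [if_pos h, s_apply_val (by omega) (by omega)]
    split_ifs <;> omega
  · rw [if_neg h, Perm.mul_apply, s_apply_val (by omega) (by omega),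
      s_apply_val (by omega) (by omega)]
    split_ifs <;> omega

theorem descBlock_apply {k : ℕ} (hk : k ≤ 2 * n) (x : Fin (2 * (2 * n))) :
    ((((List.range k).map fun a => kappa cs (r cs (2 * n - a))).prod) x : ℕ) =
      if (x : ℕ) + k = 2 * n then 2 * n
      else if 2 * n < (x : ℕ) + k ∧ (x : ℕ) < 2 * n then (x : ℕ) - 1
      else if (x : ℕ) + 1 = 2 * n + k then 2 * n - 1
      else if 2 * n ≤ (x : ℕ) ∧ (x : ℕ) + 1 < 2 * n + k then x + 1 else x := by
  induction k generalizing x with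
  | zero =>
    simp only [List.range_zero, List.map_nil, List.prod_nil, Perm.one_apply]
    split_ifs <;> omega
  | succ k ih =>
    rw [List.range_succ, List.map_append, List.prod_append, List.map_singleton,
      List.prod_singleton, Perm.mul_apply, ih (by omega), kappa_r cs (by omega) (by omega),
      gen_apply_val]
    simp only
    split_ifs <;> omega

theorem descProd_apply {k : ℕ} (hk : k ≤ 2 * n) (x : Fin (2 * (2 * n))) :
    ((((downFrom k).map fun k =>
      ((List.range k).map fun a => kappa cs (r cs (2 * n - a))).prod).prod) x : ℕ) =
      if 2 * n ≤ (x : ℕ) + k ∧ (x : ℕ) < 2 * n then (x : ℕ) + k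
      else if 2 * n ≤ (x : ℕ) ∧ (x : ℕ) < 2 * n + k then (x : ℕ) - k else x := by
  induction k with
  | zero => simp [downFrom]
  | succ k ih =>
    rw [downFrom_succ, List.map_cons, List.prod_cons, Perm.mul_apply,
      descBlock_apply cs hk, ih (by omega)]
    split_ifs <;> omega

/-- The right factor shuffles the lower half within itself; the left factor then exchanges the two
blocks of `n` letters next to the centre, raising the values at odd positions by `n`. The upper half
follows by symmetry. -/
theorem isShuffle_kappa_tauBar : IsShuffle (kappa cs (tauBar cs)) := by
  have key : ∀ x : Fin (2 * (2 * n)), (x : ℕ) < 2 * n →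
      (kappa cs (tauBar cs) x : ℕ) = if Even (x : ℕ) then (x : ℕ) / 2 else 2 * n + x / 2 := by
    intro x hx
    have hg : ∀ i, 1 ≤ i → i < 2 * n → ∀ x : Fin (2 * (2 * n)), (x : ℕ) < 2 * n →
        (kappa cs (r cs i) x : ℕ) =
          if (x : ℕ) + 1 = i then i else if (x : ℕ) = i then i - 1 else x := by
      intro i h1 h2 x hx
      rw [kappa_r cs h1 h2.le, gen_apply_val]
      simp only
      split_ifs <;> omega
    have h := shuffleProd_apply hg le_rfl x hx
    simp only [tauBar, map_mul, map_list_prod, List.map_map, Function.comp_def, Perm.mul_apply]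
    rw [descProd_apply cs (by omega), h, if_pos hx]
    simp only [Nat.even_iff]
    split_ifs <;> omega
  intro x
  rcases Nat.lt_or_ge x (2 * n) with h | h
  · exact key x h
  · have h1 := key x.rev (by rw [Fin.val_rev]; omega)
    rw [kappa_isSym] at h1
    simp only [Fin.val_rev, Nat.even_iff] at h1 ⊢
    split_ifs at h1 ⊢ <;> omega

end SymplecticDellac

namespace SymplecticDellac
open Equiv

variable {m : ℕ}

/-! ### Boards -/

theorem rook_injective {N : ℕ} : Function.Injective (rook (N := N)) := by
  intro σ τ h
  ext1 x
  have : (x, σ x) ∈ rook τ := h ▸ (rfl : σ x = σ x)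
  exact Eq.symm this

theorem isRook_rook {N : ℕ} (σ : Perm (Fin N)) : IsRook (rook σ) :=
  ⟨fun i => ⟨σ i, rfl, fun _ h => Eq.symm h⟩,
    fun j => ⟨σ.symm j, σ.apply_symm_apply j, fun _ h => σ.eq_symm_apply.2 h⟩⟩

theorem IsRook.exists_eq_rook {N : ℕ} {R : Board N N} (hR : IsRook R) : ∃ σ, R = rook σ := by
  choose f hf hf' using hR.1
  have hinj : Function.Injective f := fun x y h =>
    (hR.2 (f y)).unique (h ▸ hf x) (hf y)
  refine ⟨Equiv.ofBijective f (Finite.injective_iff_bijective.1 hinj), ?_⟩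
  ext ⟨i, j⟩
  exact ⟨fun h => (hf' i j h).symm, fun h => by
    have h : f i = j := h
    exact h ▸ hf i⟩

theorem rook_symmetric_iff {N : ℕ} (σ : Perm (Fin N)) :
    (∀ i j, (i, j) ∈ rook σ ↔ (i.rev, j.rev) ∈ rook σ) ↔ IsSym σ := by
  constructor
  · intro h x
    exact (h x (σ x)).1 rfl
  · intro h i j
    simp only [rook, Set.mem_ofPred_eq, h i, Fin.rev_inj]

/-- The first of the two positions that are merged into the `i`-th one. -/
def evenPos (i : Fin m) : Fin (2 * m) := ⟨2 * i, by omega⟩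

/-- The second of the two positions that are merged into the `i`-th one. -/
def oddPos (i : Fin m) : Fin (2 * m) := ⟨2 * i + 1, by omega⟩

/-- The position into which `x` is merged. -/
def half (x : Fin (2 * m)) : Fin m := ⟨x / 2, by omega⟩

theorem half_eq_iff (x : Fin (2 * m)) (i : Fin m) : half x = i ↔ x = evenPos i ∨ x = oddPos i := by
  simp only [half, evenPos, oddPos, Fin.ext_iff]
  omega

theorem half_rev (x : Fin (2 * m)) : half x.rev = (half x).rev := by
  ext
  simp only [half, Fin.val_rev]
  omega

theorem mem_melt_rook (σ : Perm (Fin (2 * m))) (i : Fin m) (j : Fin (2 * m)) :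
    (i, j) ∈ melt (rook σ) ↔ ∃ x, half x = i ∧ σ x = j := by
  simp only [melt, rook, Set.mem_ofPred_eq, half, Fin.ext_iff]

theorem mem_melt_rook_iff (σ : Perm (Fin (2 * m))) (i : Fin m) (j : Fin (2 * m)) :
    (i, j) ∈ melt (rook σ) ↔ j = σ (evenPos i) ∨ j = σ (oddPos i) := by
  rw [mem_melt_rook]
  simp only [half_eq_iff]
  constructor
  · rintro ⟨x, rfl | rfl, rfl⟩ <;> simp
  · rintro (rfl | rfl)
    · exact ⟨_, Or.inl rfl, rfl⟩
    · exact ⟨_, Or.inr rfl, rfl⟩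

theorem isDellac_melt_rook {σ : Perm (Fin (2 * m))} (hb : IsBounded σ)
    (hl : ∀ x : Fin (2 * m), (x : ℕ) / 2 ≤ σ x) : IsDellac m (melt (rook σ)) where
  card := by
    have h : melt (rook σ) = (fun x => (half x, σ x)) '' Set.univ := by
      ext ⟨i, j⟩
      simp [mem_melt_rook]
    rw [h, Set.ncard_image_of_injective _ fun x y h => σ.injective (Prod.ext_iff.1 h).2,
      Set.ncard_univ, Nat.card_eq_fintype_card, Fintype.card_fin]
  col j := by
    refine ⟨half (σ.symm j), (mem_melt_rook _ _ _).2 ⟨_, rfl, σ.apply_symm_apply j⟩, ?_⟩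
    intro i hi
    obtain ⟨x, rfl, rfl⟩ := (mem_melt_rook _ _ _).1 hi
    rw [σ.symm_apply_apply]
  row i := by
    have h : {j | (i, j) ∈ melt (rook σ)} = {σ (evenPos i), σ (oddPos i)} := by
      ext j
      simp [mem_melt_rook_iff]
    rw [h, Set.ncard_pair]
    simp [σ.injective.eq_iff, evenPos, oddPos]
  bound i j h := by
    obtain ⟨x, rfl, rfl⟩ := (mem_melt_rook _ _ _).1 h
    exact ⟨hl x, hb x⟩

theorem melt_rook_symmetric {σ : Perm (Fin (2 * m))} (hs : IsSym σ) (i : Fin m)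
    (j : Fin (2 * m)) : (i, j) ∈ melt (rook σ) ↔ (i.rev, j.rev) ∈ melt (rook σ) := by
  have key : ∀ (i : Fin m) (j : Fin (2 * m)), (i, j) ∈ melt (rook σ) →
      (i.rev, j.rev) ∈ melt (rook σ) := by
    intro i j h
    obtain ⟨x, rfl, rfl⟩ := (mem_melt_rook _ _ _).1 h
    exact (mem_melt_rook _ _ _).2 ⟨x.rev, half_rev x, hs x⟩
  exact ⟨key i j, fun h => by simpa using key _ _ h⟩

theorem PairIncreasing.evenPos_lt_oddPos {σ : Perm (Fin (2 * m))} (hp : PairIncreasing σ)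
    (i : Fin m) : σ (evenPos i) < σ (oddPos i) :=
  hp _ _ (by simp [evenPos]) rfl

/-- Merging forgets only the order within a pair of rows, and `hp` prescribes that order. -/
theorem blow_melt_rook {σ : Perm (Fin (2 * m))} (hp : PairIncreasing σ) :
    blow (melt (rook σ)) = rook σ := by
  ext ⟨x, y⟩
  simp only [blow, Set.mem_ofPred_eq, mem_melt_rook_iff]
  constructor
  · rintro ⟨i, j, k, hj, hk, hjk, h⟩
    have hi := hp.evenPos_lt_oddPos i
    have h1 : j = σ (evenPos i) ∧ k = σ (oddPos i) := by
      rcases hj with rfl | rfl <;> rcases hk with rfl | rfl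
      · exact absurd hjk (lt_irrefl _)
      · exact ⟨rfl, rfl⟩
      · exact absurd hjk (not_lt.2 hi.le)
      · exact absurd hjk (lt_irrefl _)
    obtain ⟨rfl, rfl⟩ := h1
    rcases h with ⟨h, rfl⟩ | ⟨h, rfl⟩
    · exact congrArg σ (Fin.ext h)
    · exact congrArg σ (Fin.ext h)
  · intro h
    obtain rfl : σ x = y := h
    refine ⟨half x, _, _, Or.inl rfl, Or.inr rfl, hp.evenPos_lt_oddPos _, ?_⟩
    rcases (half_eq_iff x (half x)).1 rfl with h | h
    · exact Or.inl ⟨congrArg Fin.val h, congrArg σ h⟩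
    · exact Or.inr ⟨congrArg Fin.val h, congrArg σ h⟩

theorem IsDellac.exists_eq_melt_rook {C : Board m (2 * m)} (hC : IsDellac m C) :
    ∃ σ, PairIncreasing σ ∧ IsBounded σ ∧ C = melt (rook σ) := by
  have hrow : ∀ i, ∃ p : Fin (2 * m) × Fin (2 * m), p.1 < p.2 ∧
      ∀ j, (i, j) ∈ C ↔ j = p.1 ∨ j = p.2 := by
    intro i
    obtain ⟨x, y, hxy, h⟩ := Set.ncard_eq_two.1 (hC.row i)
    have h' : ∀ j, (i, j) ∈ C ↔ j = x ∨ j = y := fun j => by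
      simpa using Set.ext_iff.1 h j
    rcases lt_or_gt_of_ne hxy with h1 | h1
    · exact ⟨(x, y), h1, h'⟩
    · exact ⟨(y, x), h1, fun j => by rw [h', or_comm]⟩
  choose p hp hpC using hrow
  let f : Fin (2 * m) → Fin (2 * m) := fun x =>
    if Even (x : ℕ) then (p (half x)).1 else (p (half x)).2
  have hfC : ∀ x, (half x, f x) ∈ C := by
    intro x
    rw [hpC]
    simp only [f]
    split_ifs <;> simp
  have hinj : Function.Injective f := by
    intro x y hxy
    have h1 : half x = half y := (hC.col (f y)).unique (hxy ▸ hfC x) (hfC y)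
    have h2 := hp (half y)
    have h3 := congrArg Fin.val h1
    simp only [half] at h3
    simp only [f, h1, Nat.even_iff] at hxy
    split_ifs at hxy with h4 h5 h5
    · exact Fin.ext (by omega)
    · exact absurd hxy h2.ne
    · exact absurd hxy h2.ne'
    · exact Fin.ext (by omega)
  refine ⟨Equiv.ofBijective f (Finite.injective_iff_bijective.1 hinj), ?_, ?_, ?_⟩
  · intro x y hx hy
    have h1 : half x = half y := by
      rw [Nat.even_iff] at hx
      simp only [half, Fin.ext_iff]
      omega
    have hy' : ¬ Even (y : ℕ) := by
      rw [hy, Nat.not_even_iff_odd]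
      exact hx.add_one
    simp only [Equiv.ofBijective_apply, f, hx, hy', if_true, if_false, h1]
    exact hp _
  · exact fun x => (hC.bound _ _ (hfC x)).2
  · ext ⟨i, j⟩
    rw [mem_melt_rook]
    constructor
    · intro h
      rcases (hpC i j).1 h with rfl | rfl
      · refine ⟨evenPos i, (half_eq_iff _ _).2 (Or.inl rfl), ?_⟩
        have h1 : half (evenPos i) = i := (half_eq_iff _ _).2 (Or.inl rfl)
        simp [f, h1]
        simp [evenPos]
      · refine ⟨oddPos i, (half_eq_iff _ _).2 (Or.inr rfl), ?_⟩
        have h1 : half (oddPos i) = i := (half_eq_iff _ _).2 (Or.inr rfl)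
        simp [f, h1]
        simp [oddPos]
    · rintro ⟨x, rfl, rfl⟩
      exact hfC x

/-- Reversal matches the two marks of row `i` with those of row `i.rev` and reverses their order, so
the smaller one must go to the larger one. -/
theorem isSym_of_melt_rook_symmetric {σ : Perm (Fin (2 * m))} (hp : PairIncreasing σ)
    (h : ∀ i j, (i, j) ∈ melt (rook σ) ↔ (i.rev, j.rev) ∈ melt (rook σ)) : IsSym σ := by
  have key : ∀ i : Fin m, σ (evenPos i.rev) = (σ (oddPos i)).rev ∧
      σ (oddPos i.rev) = (σ (evenPos i)).rev := by
    intro i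
    have h1 := (mem_melt_rook_iff _ _ _).1
      ((h i _).1 ((mem_melt_rook_iff σ i _).2 (Or.inl rfl)))
    have h2 := (mem_melt_rook_iff _ _ _).1
      ((h i _).1 ((mem_melt_rook_iff σ i _).2 (Or.inr rfl)))
    have h3 : (σ (oddPos i)).rev < (σ (evenPos i)).rev :=
      Fin.rev_lt_rev.2 (hp.evenPos_lt_oddPos i)
    have h4 := hp.evenPos_lt_oddPos i.rev
    rcases h1 with h1 | h1 <;> rcases h2 with h2 | h2 <;> rw [h1, h2] at h3
    · exact absurd h3 (lt_irrefl _)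
    · exact absurd h3 (not_lt.2 h4.le)
    · exact ⟨h2.symm, h1.symm⟩
    · exact absurd h3 (lt_irrefl _)
  intro x
  rcases (half_eq_iff x (half x)).1 rfl with h1 | h1
  · have h2 : x.rev = oddPos (half x).rev := by
      rw [Fin.ext_iff] at h1 ⊢
      simp only [evenPos, oddPos, Fin.val_rev] at h1 ⊢
      omega
    rw [h2, (key _).2, ← h1]
  · have h2 : x.rev = evenPos (half x).rev := by
      rw [Fin.ext_iff] at h1 ⊢
      simp only [evenPos, oddPos, Fin.val_rev] at h1 ⊢
      omega
    rw [h2, (key _).1, ← h1]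

/-- The mark below and to the left is taken in the same row if that row is even and in the next row
if it is odd, where increase within the pair supplies the extra unit. The other mark comes from
applying this to the mirror image. -/
theorem rook_subset_hull_shuffle {σ τ : Perm (Fin (2 * m))} (hτ : IsShuffle τ) (hs : IsSym σ)
    (hp : PairIncreasing σ) (hb : IsBounded σ) : rook σ ⊆ hull (rook τ) := by
  have lower : ∀ x, ∃ q, x ≤ q ∧ τ q ≤ σ x := by
    intro x
    have hl := hb.div_two_le hs x
    have hτx := hτ x
    by_cases hx : Even (x : ℕ)
    · refine ⟨x, le_rfl, ?_⟩
      rw [if_pos hx] at hτx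
      rw [Fin.le_def]
      omega
    rw [Nat.even_iff] at hx
    rcases Nat.lt_or_ge (x + 1) (2 * m) with h | h
    · have h1 := hp ⟨x - 1, by omega⟩ x (by rw [Nat.even_iff]; dsimp only; omega)
        (by dsimp only; omega)
      have h2 := hb.div_two_le hs ⟨x - 1, by omega⟩
      have h3 := hτ ⟨x + 1, h⟩
      rw [if_pos (by rw [Nat.even_iff]; dsimp only; omega)] at h3
      refine ⟨⟨x + 1, h⟩, by rw [Fin.le_def]; dsimp only; omega, ?_⟩
      rw [Fin.le_def, h3]
      rw [Fin.lt_def] at h1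
      dsimp only at h2 ⊢
      omega
    -- The last row has no successor, but its mark is forced: the largest value fits only in the
    -- last pair, and there it must come second.
    · refine ⟨x, le_rfl, ?_⟩
      have h1 : (σ x : ℕ) = 2 * m - 1 := by
        let p := σ.symm ⟨2 * m - 1, by omega⟩
        have hpv : (σ p : ℕ) = 2 * m - 1 := by simp [p]
        have h2 := hb p
        by_cases hpx : p = x
        · rw [← hpx, hpv]
        · rw [Fin.ext_iff] at hpx
          have h3 := hp p x (by rw [Nat.even_iff]; omega) (by omega)
          rw [Fin.lt_def] at h3
          omega
      rw [Fin.le_def]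
      omega
  rintro ⟨x, y⟩ (rfl : σ x = y)
  refine ⟨?_, ?_⟩
  · obtain ⟨q, hq, hq'⟩ := lower x
    exact ⟨(q, τ q), rfl, hq, hq'⟩
  · obtain ⟨q, hq, hq'⟩ := lower x.rev
    refine ⟨(q.rev, τ q.rev), rfl, by simpa [Fin.rev_le_iff] using hq, ?_⟩
    have h1 : τ q.rev = (τ q).rev := by
      ext
      have h2 := hτ q
      simp only [hτ q.rev, Fin.val_rev, h2, Nat.even_iff]
      split_ifs <;> omega
    rw [hs] at hq'
    rw [h1]
    exact Fin.le_rev_iff.2 hq'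

/-- Neither symmetry nor increase on pairs is needed here, so `melt` can be applied to all of `SR`,
where it need not be injective. -/
theorem bounds_of_subset_hull {σ τ : Perm (Fin (2 * m))} (hτ : IsShuffle τ)
    (h : rook σ ⊆ hull (rook τ)) :
    IsBounded σ ∧ ∀ x : Fin (2 * m), (x : ℕ) / 2 ≤ σ x := by
  refine ⟨fun x => ?_, fun x => ?_⟩
  · obtain ⟨-, ⟨q, y⟩, (rfl : τ q = y), h1, h2⟩ := h (show (x, σ x) ∈ rook σ from rfl)
    have h3 := hτ q
    rw [Fin.le_def] at h1 h2
    dsimp only at h1 h2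
    split_ifs at h3 <;> omega
  · obtain ⟨⟨⟨q, y⟩, (rfl : τ q = y), h1, h2⟩, -⟩ := h (show (x, σ x) ∈ rook σ from rfl)
    have h3 := hτ q
    rw [Fin.le_def] at h1 h2
    dsimp only at h1 h2
    split_ifs at h3 <;> omega

/-! ### Blow and melt between symplectic Dellac configurations and symmetric rook arrangements. -/

theorem exists_of_mem_SpDC {n : ℕ} {C : Board (2 * n) (2 * (2 * n))} (hC : C ∈ SpDC n) :
    ∃ σ, IsSym σ ∧ PairIncreasing σ ∧ IsBounded σ ∧ C = melt (rook σ) := by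
  obtain ⟨σ, hp, hb, rfl⟩ := hC.1.exists_eq_melt_rook
  exact ⟨σ, isSym_of_melt_rook_symmetric hp hC.2, hp, hb, rfl⟩

theorem melt_rook_mem_SpDC {n : ℕ} {σ : Perm (Fin (2 * (2 * n)))} (hs : IsSym σ)
    (hb : IsBounded σ) : melt (rook σ) ∈ SpDC n :=
  ⟨isDellac_melt_rook hb (hb.div_two_le hs), melt_rook_symmetric hs⟩

theorem mapsTo_blow (n : ℕ) : Set.MapsTo blow (SpDC n) (SR n) := by
  intro C hC
  obtain ⟨σ, hs, hp, hb, rfl⟩ := exists_of_mem_SpDC hC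
  rw [blow_melt_rook hp]
  exact ⟨isRook_rook σ, (rook_symmetric_iff σ).2 hs,
    rook_subset_hull_shuffle (isShuffle_tau _) hs hp hb⟩

theorem mapsTo_melt (n : ℕ) : Set.MapsTo melt (SR n) (SpDC n) := by
  rintro R ⟨hR, hsym, hhull⟩
  obtain ⟨σ, rfl⟩ := hR.exists_eq_rook
  exact melt_rook_mem_SpDC ((rook_symmetric_iff σ).1 hsym)
    (bounds_of_subset_hull (isShuffle_tau _) hhull).1

theorem melt_blow {n : ℕ} {C : Board (2 * n) (2 * (2 * n))} (hC : C ∈ SpDC n) :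
    melt (blow C) = C := by
  obtain ⟨σ, hs, hp, hb, rfl⟩ := exists_of_mem_SpDC hC
  rw [blow_melt_rook hp]

/-! ### The bijections from the Bruhat interval. -/

section Bijections

variable {W : Type*} [Group W] {n : ℕ} (cs : CoxeterSystem (CoxeterMatrix.B (2 * n)) W)

theorem bijOn_melt_rook_kappa :
    Set.BijOn (fun w => melt (rook (kappa cs w))) (minRepsLE cs (J n) (tauBar cs)) (SpDC n) := by
  have ht := isShuffle_kappa_tauBar cs
  refine ⟨fun w hw => ?_, fun w hw v hv h => ?_, fun C hC => ?_⟩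
  · exact melt_rook_mem_SpDC (kappa_isSym cs w) ((mem_minRepsLE_iff cs ht).1 hw).2
  · have h1 := congrArg blow h
    simp only at h1
    rw [blow_melt_rook ((mem_minRepsLE_iff cs ht).1 hw).1,
      blow_melt_rook ((mem_minRepsLE_iff cs ht).1 hv).1] at h1
    exact kappa_injective cs (rook_injective h1)
  · obtain ⟨σ, hs, hp, hb, rfl⟩ := exists_of_mem_SpDC hC
    obtain ⟨w, rfl⟩ : σ ∈ Set.range (kappa cs) := by
      rw [range_kappa]
      exact hs
    exact ⟨w, (mem_minRepsLE_iff cs ht).2 ⟨hp, hb⟩, rfl⟩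

theorem bijOn_rook_kappa :
    Set.BijOn (fun w => rook (kappa cs w)) (minRepsLE cs (J n) (tauBar cs))
      (blow '' SpDC n) := by
  have h := bijOn_melt_rook_kappa cs
  have hblow : ∀ w ∈ minRepsLE cs (J n) (tauBar cs),
      blow (melt (rook (kappa cs w))) = rook (kappa cs w) := fun w hw =>
    blow_melt_rook ((mem_minRepsLE_iff cs (isShuffle_kappa_tauBar cs)).1 hw).1
  refine ⟨fun w hw => ⟨_, h.mapsTo hw, hblow w hw⟩,
    fun w _ v _ e => kappa_injective cs (rook_injective e), ?_⟩
  rintro _ ⟨C, hC, rfl⟩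
  obtain ⟨w, hw, rfl⟩ := h.surjOn hC
  exact ⟨w, hw, (hblow w hw).symm⟩

end Bijections

end SymplecticDellac

theorem theorem2p1 {W : Type*} [Group W] (n : ℕ) (hn : 1 ≤ n)
    (cs : CoxeterSystem (CoxeterMatrix.B (2 * n)) W) :
    -- the numerical identity `e_n = # W^J_{≤ τ̄_{2n}}`
    (SymplecticDellac.minRepsLE cs (SymplecticDellac.J n) (SymplecticDellac.tauBar cs)).Finite ∧
    SymplecticDellac.e n =
      (SymplecticDellac.minRepsLE cs (SymplecticDellac.J n) (SymplecticDellac.tauBar cs)).ncard ∧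
    -- blow and melt restrict to maps between `SpDC_{2n}` and `SR_{≤ τ_{2n}}`, with `m' ∘ b' = id`
    Set.MapsTo SymplecticDellac.blow (SymplecticDellac.SpDC n) (SymplecticDellac.SR n) ∧
    Set.MapsTo SymplecticDellac.melt (SymplecticDellac.SR n) (SymplecticDellac.SpDC n) ∧
    (∀ C ∈ SymplecticDellac.SpDC n, SymplecticDellac.melt (SymplecticDellac.blow C) = C) ∧
    -- the embedding `κ` of the Weyl group onto the `ι`-fixed permutations
    ∃ κ : W →* Equiv.Perm (Fin (2 * (2 * n))),
      (∀ i : ℕ, 1 ≤ i → i ≤ 2 * n →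
        κ (SymplecticDellac.r cs i) = SymplecticDellac.kappaGen n i) ∧
      Function.Injective κ ∧
      Set.range κ = {σ | SymplecticDellac.iota σ = σ} ∧
      κ (SymplecticDellac.tauBar cs) = SymplecticDellac.tau (2 * n) ∧
      -- `w ↦ melt (R_{κ(w)})` is a bijection `W^J_{≤ τ̄_{2n}} → SpDC_{2n}`, inverted by `blow`
      Set.BijOn (fun w => SymplecticDellac.melt (SymplecticDellac.rook (κ w)))
        (SymplecticDellac.minRepsLE cs (SymplecticDellac.J n) (SymplecticDellac.tauBar cs))
        (SymplecticDellac.SpDC n) ∧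
      Set.BijOn (fun w => SymplecticDellac.rook (κ w))
        (SymplecticDellac.minRepsLE cs (SymplecticDellac.J n) (SymplecticDellac.tauBar cs))
        (SymplecticDellac.blow '' SymplecticDellac.SpDC n) := by
  have := SymplecticDellac.group_finite cs
  have hbij := SymplecticDellac.bijOn_melt_rook_kappa cs
  refine ⟨Set.toFinite _, ?_, SymplecticDellac.mapsTo_blow n, SymplecticDellac.mapsTo_melt n,
    fun C hC => SymplecticDellac.melt_blow hC, SymplecticDellac.kappa cs, fun i h1 h2 => ?_,
    SymplecticDellac.kappa_injective cs, ?_,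
    (SymplecticDellac.isShuffle_kappa_tauBar cs).eq (SymplecticDellac.isShuffle_tau _), hbij,
    SymplecticDellac.bijOn_rook_kappa cs⟩
  · rw [SymplecticDellac.e, ← hbij.image_eq, hbij.injOn.ncard_image]
  · rw [SymplecticDellac.kappa_r cs h1 h2, SymplecticDellac.kappaGen_eq_gen h1 h2]
  · rw [SymplecticDellac.range_kappa]
    ext σ
    exact (SymplecticDellac.iota_eq_self_iff σ).symm
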